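/- Let $X=(X_s)_{s\ge 0}$ be a real-valued Lévy process with Lévy measure $\Lambda$, that is, $\Lambda(\{0\})=0$ and $\Lambda(B)$ is the expected number of $s\in(0,1]$ with $\Delta X_s=X_s-X_{s-}\in B$, for every Borel set $B\not\ni 0$ (no assumption is made on the Gaussian component). Write $\overline\Lambda_+(x)=\Lambda((x,\infty))$, $\varphi(u)=\sup\{x>0:\overline\Lambda_+(x)>u\}$ for $u>0$, and $a(t)=\varphi(1/t)$ for $t>0$. Let $$m_s=\sup_{u\le s}\Delta X_u,\qquad M_t=\sup_{t\le s\le 1}\frac{m_s}{a(s)}\qquad(0<t\le 1).$$ Let $\alpha\in(0,2)$, and assume that $\overline\Lambda_+(x)=x^{-\alpha}\ell(x)$ for all $x>0$, where $\ell$ is a measurable function on $(0,\infty)$ that is super-slowly varying at $0$ with auxiliary function $\xi(t)=(-\log t)^{-1}$; this means that for some $\Delta>0$, $$\lim_{t\downarrow 0}\frac{\ell\big(t\,\xi(t)^{\delta}\big)}{\ell(t)}=1\quad\text{uniformly in }\delta\in[0,\Delta].$$ Then for every $x>0$, $$\lim_{t\downarrow 0}\mathbf P\big(M_t\,(-\log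 t)^{-1/\alpha}\le x\big)=e^{-x^{-\alpha}}.$$ -/

import Mathlib

open MeasureTheory ProbabilityTheory Filter Topology Set
open scoped NNReal ENNReal

noncomputable section

/-- A path is right-continuous with (finite) left limits. -/
def IsCadlagPath (f : ℝ≥0 → ℝ) : Prop :=
  ∀ t : ℝ≥0, ContinuousWithinAt f (Ici t) t ∧ ∃ l : ℝ, Tendsto f (𝓝[<] t) (𝓝 l)

/-- The jump `f t - f (t-)` of a path at time `t`. It is `0` at time `t = 0`, where Mathlib's
left limit is the value of the function. -/
def pathJump (f : ℝ≥0 → ℝ) (t : ℝ≥0) : ℝ := f t - Function.leftLim f t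

/-- Real-valued Lévy processes: started at `0`, with independent and stationary increments and
almost surely càdlàg paths. -/
structure IsLevyProcess {Ω : Type*} [MeasurableSpace Ω] (X : ℝ≥0 → Ω → ℝ) (P : Measure Ω) :
    Prop where
  measurable : ∀ t, Measurable (X t)
  start_zero : ∀ᵐ ω ∂P, X 0 ω = 0
  indep_increments : HasIndepIncrements X P
  stationary_increments : ∀ s t : ℝ≥0,
    IdentDistrib (fun ω => X (s + t) ω - X s ω) (fun ω => X t ω - X 0 ω) P P
  cadlag : ∀ᵐ ω ∂P, IsCadlagPath (fun t => X t ω)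

/-- `Λ` is the Lévy measure of `X`: it does not charge `0`, and for every Borel set `B` that does
not contain `0`, `Λ B` is the expected number of jumps of `X` with size in `B` per unit of time. -/
def IsLevyMeasure {Ω : Type*} [MeasurableSpace Ω] (X : ℝ≥0 → Ω → ℝ) (P : Measure Ω)
    (Λ : Measure ℝ) : Prop :=
  Λ {0} = 0 ∧ ∀ B : Set ℝ, MeasurableSet B → (0 : ℝ) ∉ B →
    Λ B = ∫⁻ ω, (({s : ℝ≥0 | s ∈ Ioc 0 1 ∧ pathJump (fun t => X t ω) s ∈ B}.encard : ℕ∞) : ℝ≥0∞) ∂P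

/-- `φ(u) = sup {x > 0 : Λ((x, ∞)) > u}`. -/
def tailInverse (Λ : Measure ℝ) (u : ℝ) : ℝ :=
  sSup {x : ℝ | 0 < x ∧ ENNReal.ofReal u < Λ (Ioi x)}

/-- The scaling function `a(t) = φ(1/t)`. -/
def scaling (Λ : Measure ℝ) (t : ℝ) : ℝ := tailInverse Λ (1 / t)

/-- The largest jump of a path up to time `t`. -/
def maxJump (f : ℝ≥0 → ℝ) (t : ℝ≥0) : ℝ := sSup (pathJump f '' Iic t)

/-- `M_t = sup_{t ≤ s ≤ 1} m_s / a(s)`, for one path `f`. -/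
def scaledMaxJump (Λ : Measure ℝ) (f : ℝ≥0 → ℝ) (t : ℝ≥0) : ℝ :=
  sSup ((fun s : ℝ≥0 => maxJump f s / scaling Λ s) '' Icc t 1)

/-- `ℓ`, a measurable function on `(0, ∞)`, is super-slowly varying at `0` with auxiliary
function `ξ`. -/
def IsSuperSlowlyVarying (ℓ ξ : ℝ → ℝ) : Prop :=
  Measurable (fun x : Ioi (0 : ℝ) => ℓ x) ∧
    ∃ Δ : ℝ, 0 < Δ ∧
      TendstoUniformlyOn (fun t δ : ℝ => ℓ (t * ξ t ^ δ) / ℓ t) (fun _ => 1) (𝓝[>] (0 : ℝ))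
        (Icc 0 Δ)

end

/-! Put `y = x (-log t)^(1/α)`. Since `a` is nondecreasing, the event says that every jump at a time
`u ∈ (0, 1]` stays below the barrier `y a(max u t)`. Jumps form a Poisson process, so with `G c =
Λ((c, ∞))` the probability is `exp (-∫₀¹ G (y a(max u t)) du)` (`measure_jumps_le_barrier`), and the
integral must tend to `x^(-α)` (`tendsto_integral`).

The Poisson formula is obtained by hand. Jumps in the cells of a regular grid are detected by
increments over finer grids, which makes the cells independent and identically distributed. If `p_n`
is the probability of no jump above `c` in a cell of length `1/n`, then `p_n^n = p_1`, while
counting the cells that are hit gives `n (1 - p_n) → G c`; hence `p_n = exp (-G c / n)`. Step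
functions on both sides of the barrier then yield the integral.

For the integral, super-slow variation gives `G (y a(s)) ≈ y^(-α) / s` uniformly in `2 ≤ y ≤ (-log
s)^(2/α)`. This covers `t ≤ s ≤ s₁ = exp (-y^(α/2))` and contributes about `y^(-α) (-log t -
y^(α/2))`, which tends to `x^(-α)` because `y^(α/2)` is of order `(-log t)^(1/2)`. Between `s₁` and
a fixed small `s₀`, monotonicity of `G` allows replacing `y` by `(-log s)^(2/α)`, so the integrand
is at most about `1 / (s log² s)`, with small integral. The ranges `[0, t]` and `[s₀, 1]` contribute
negligibly. -/

/-! ### Jumps of càdlàg paths -/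

lemma pathJump_zero (f : ℝ≥0 → ℝ) : pathJump f 0 = 0 := by
  rw [pathJump, leftLim_eq_of_isBot (fun x => zero_le), sub_self]

lemma IsCadlagPath.exists_local_bound {f : ℝ≥0 → ℝ} (hf : IsCadlagPath f) (u : ℝ≥0) {ε : ℝ}
    (hε : 0 < ε) :
    ∃ η > 0, (∀ v, u ≤ v → dist v u < η → |f v - f u| < ε) ∧
      ∀ v, v < u → dist v u < η → |f v - Function.leftLim f u| < ε := by
  obtain ⟨h1, h2⟩ := hf u
  have h3 := tendsto_leftLim_of_tendsto h2
  obtain ⟨η₁, h₁, H₁⟩ := Metric.continuousWithinAt_iff.1 h1 ε hε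
  obtain ⟨η₂, h₂, H₂⟩ := Metric.tendsto_nhdsWithin_nhds.1 h3 ε hε
  refine ⟨min η₁ η₂, lt_min h₁ h₂, fun v hv hd => ?_, fun v hv hd => ?_⟩
  · exact H₁ hv (hd.trans_le (min_le_left _ _))
  · exact H₂ hv (hd.trans_le (min_le_right _ _))

/-- If all jumps of a càdlàg path over `(p, q]` are at most `c`, then its increments over short
subintervals are at most `c'`, for every positive `c' > c`. -/
lemma IsCadlagPath.exists_increment_le {f : ℝ≥0 → ℝ} (hf : IsCadlagPath f) {p q : ℝ≥0} {c c' : ℝ}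
    (hc : c < c') (hc' : 0 < c') (h : ∀ u ∈ Ioc p q, pathJump f u ≤ c) :
    ∃ δ > 0, ∀ r s, p ≤ r → r ≤ s → s ≤ q → dist s r < δ → f s - f r ≤ c' := by
  -- The first bound gives `c + 2ε ≤ c'` when the interval straddles a centre `u`; the second gives
  -- `2ε ≤ c'` when it lies on one side of `u`.
  set ε := min ((c' - c) / 2) (c' / 2) with hεdef
  have hε : 0 < ε := lt_min (by linarith) (by linarith)
  have hε1 : ε ≤ (c' - c) / 2 := min_le_left _ _
  have hε2 : ε ≤ c' / 2 := min_le_right _ _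
  choose η hη hr hl using fun u => hf.exists_local_bound u hε
  obtain ⟨δ, hδ, H⟩ := lebesgue_number_lemma_of_metric (s := Icc p q)
    (c := fun u => Metric.ball u (η u)) isCompact_Icc (fun _ => Metric.isOpen_ball)
    (fun u _ => mem_iUnion.2 ⟨u, Metric.mem_ball_self (hη u)⟩)
  refine ⟨δ, hδ, fun r s hpr hrs hsq hd => ?_⟩
  obtain ⟨u, hu⟩ := H r ⟨hpr, hrs.trans hsq⟩
  have hru : dist r u < η u := hu (Metric.mem_ball_self hδ)
  have hsu : dist s u < η u := hu hd
  rcases le_or_gt u r with h1 | h1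
  · have := abs_lt.1 (hr u r h1 hru)
    have := abs_lt.1 (hr u s (h1.trans hrs) hsu)
    linarith
  · rcases le_or_gt u s with h2 | h2
    · have := abs_lt.1 (hl u r h1 hru)
      have := abs_lt.1 (hr u s h2 hsu)
      have h3 := h u ⟨hpr.trans_lt h1, h2.trans hsq⟩
      rw [pathJump] at h3
      linarith
    · have := abs_lt.1 (hl u r h1 hru)
      have := abs_lt.1 (hl u s h2 hsu)
      linarith

/-- Increments over short intervals `(r, s] ∋ u` exceed `c` if the jump at `u` exceeds `c`. -/
lemma IsCadlagPath.exists_lt_increment {f : ℝ≥0 → ℝ} (hf : IsCadlagPath f) {u : ℝ≥0} {c : ℝ}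
    (h : c < pathJump f u) :
    ∃ δ > 0, ∀ r s, r < u → u ≤ s → dist s r < δ → c < f s - f r := by
  obtain ⟨η, hη, hr, hl⟩ := hf.exists_local_bound u (ε := (pathJump f u - c) / 2) (by linarith)
  refine ⟨η, hη, fun r s hru hus hd => ?_⟩
  have hd' : (s : ℝ) - r < η := (le_abs_self _).trans_lt hd
  have h1 : (r : ℝ) < u := hru
  have h2 : (u : ℝ) ≤ s := hus
  have := abs_lt.1 (hl r hru (by rw [NNReal.dist_eq, abs_lt]; constructor <;> linarith))
  have := abs_lt.1 (hr s hus (by rw [NNReal.dist_eq, abs_lt]; constructor <;> linarith))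
  rw [pathJump] at *
  linarith

lemma abs_leftLim_le_of_eventually {f : ℝ≥0 → ℝ} (hf : IsCadlagPath f) {v : ℝ≥0} {C : ℝ}
    (h : ∀ᶠ w in 𝓝 v, |f w| ≤ C) : |Function.leftLim f v| ≤ C := by
  rcases eq_or_neBot (𝓝[<] v) with h0 | h0
  · rw [leftLim_eq_of_eq_bot f h0]
    exact h.self_of_nhds
  · exact le_of_tendsto (tendsto_leftLim_of_tendsto (hf v).2).abs (nhdsWithin_le_nhds h)

/-- Local boundedness and compactness of `[0, t]`. Without it the real `sSup` in `maxJump` could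
take its default value `0`. -/
lemma IsCadlagPath.bddAbove_pathJump {f : ℝ≥0 → ℝ} (hf : IsCadlagPath f) (t : ℝ≥0) :
    BddAbove (pathJump f '' Iic t) := by
  have hI : Iic t = Icc 0 t := by ext x; simp
  rw [hI]
  refine (isCompact_Icc (a := (0 : ℝ≥0)) (b := t)).induction_on
    (p := fun s => BddAbove (pathJump f '' s)) (by simp) (fun s s' hs h => h.mono (image_mono hs))
    (fun s s' hs hs' => by rw [image_union]; exact hs.union hs') (fun u _ => ?_)
  obtain ⟨η, hη, hr, hl⟩ := hf.exists_local_bound u one_pos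
  refine ⟨Metric.ball u η, mem_nhdsWithin_of_mem_nhds (Metric.ball_mem_nhds u hη), ?_⟩
  have hC : ∀ v ∈ Metric.ball u η, |f v| ≤ |f u| + |Function.leftLim f u| + 1 := by
    intro v hv
    have := abs_nonneg (f u)
    have := abs_nonneg (Function.leftLim f u)
    rcases le_or_gt u v with h | h
    · have h1 := hr v h hv
      have := abs_sub_abs_le_abs_sub (f v) (f u)
      linarith
    · have h1 := hl v h hv
      have := abs_sub_abs_le_abs_sub (f v) (Function.leftLim f u)
      linarith
  refine ⟨2 * (|f u| + |Function.leftLim f u| + 1), ?_⟩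
  rintro _ ⟨v, hv, rfl⟩
  have h1 := hC v hv
  have h2 := abs_leftLim_le_of_eventually hf
    (Filter.mem_of_superset (Metric.isOpen_ball.mem_nhds hv) hC)
  rw [pathJump]
  linarith [le_abs_self (f v), neg_abs_le (Function.leftLim f v)]

lemma maxJump_le_iff {f : ℝ≥0 → ℝ} (hf : IsCadlagPath f) (t : ℝ≥0) (c : ℝ) :
    maxJump f t ≤ c ↔ ∀ u ≤ t, pathJump f u ≤ c := by
  rw [maxJump, csSup_le_iff (hf.bddAbove_pathJump t) ⟨_, mem_image_of_mem _ (mem_Iic.2 zero_le)⟩]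
  simp

lemma maxJump_nonneg {f : ℝ≥0 → ℝ} (hf : IsCadlagPath f) (t : ℝ≥0) : 0 ≤ maxJump f t := by
  rw [← pathJump_zero f]
  exact (maxJump_le_iff hf t _).1 le_rfl 0 zero_le

lemma maxJump_mono {f : ℝ≥0 → ℝ} (hf : IsCadlagPath f) : Monotone (maxJump f) := fun _ _ hst =>
  (maxJump_le_iff hf _ _).2 fun u hu => (maxJump_le_iff hf _ _).1 le_rfl u (hu.trans hst)

/-- A jump at `u` enters `m_s` for every `s ≥ u`. Since `a` is nondecreasing, the tightest
constraint on it with `s ≥ t` is the one at `s = max u t`. -/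
lemma scaledMaxJump_le_iff {Λ : Measure ℝ} {f : ℝ≥0 → ℝ} (hf : IsCadlagPath f)
    (hpos : ∀ s : ℝ, 0 < s → 0 < scaling Λ s) (hmono : MonotoneOn (scaling Λ) (Ioi 0))
    {t : ℝ≥0} (ht : 0 < t) (ht1 : t ≤ 1) {y : ℝ} (hy : 0 < y) :
    scaledMaxJump Λ f t ≤ y ↔
      ∀ u ∈ Ioc (0 : ℝ≥0) 1, pathJump f u ≤ y * scaling Λ (max u t : ℝ≥0) := by
  have hbdd : BddAbove ((fun s : ℝ≥0 => maxJump f s / scaling Λ s) '' Icc t 1) := by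
    refine ⟨maxJump f 1 / scaling Λ t, ?_⟩
    rintro _ ⟨s, hs, rfl⟩
    have hs0 : 0 < s := ht.trans_le hs.1
    exact div_le_div₀ (maxJump_nonneg hf 1) (maxJump_mono hf hs.2) (hpos t ht)
      (hmono (mem_Ioi.2 ht) (mem_Ioi.2 hs0) hs.1)
  rw [scaledMaxJump, csSup_le_iff hbdd ⟨_, mem_image_of_mem _ ⟨le_rfl, ht1⟩⟩]
  simp only [forall_mem_image]
  constructor
  · intro h u hu
    have h1 := h (x := max u t) ⟨le_max_right _ _, max_le hu.2 ht1⟩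
    rw [div_le_iff₀ (hpos _ (by exact_mod_cast ht.trans_le (le_max_right u t)))] at h1
    exact (maxJump_le_iff hf _ _).1 h1 u (le_max_left _ _)
  · intro h s hs
    have hs0 : 0 < s := ht.trans_le hs.1
    refine (div_le_iff₀ (hpos _ hs0)).2 ((maxJump_le_iff hf _ _).2 fun u hu => ?_)
    rcases eq_or_ne u 0 with rfl | hu0
    · rw [pathJump_zero]
      exact (mul_pos hy (hpos _ hs0)).le
    · refine (h u ⟨pos_iff_ne_zero.2 hu0, hu.trans hs.2⟩).trans ?_
      refine mul_le_mul_of_nonneg_left (hmono ?_ (mem_Ioi.2 hs0) ?_) hy.le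
      · exact mem_Ioi.2 (by exact_mod_cast ht.trans_le (le_max_right u t))
      · exact_mod_cast max_le hu hs.1

/-! ### Detecting jumps in a cell by increments over a finer grid -/

/-- The event that all jumps during the time interval `(k / n, (k + 1) / n]` are at most `c`. -/
def cellJumpsLE {Ω : Type*} (X : ℝ≥0 → Ω → ℝ) (n k : ℕ) (c : ℝ) : Set Ω :=
  {ω | ∀ u ∈ Ioc ((k : ℝ≥0) / n) (((k + 1 : ℕ) : ℝ≥0) / n), pathJump (fun t => X t ω) u ≤ c}

/-- The event that the increments over the `M` cells of the regular subdivision of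
`(k / n, (k + 1) / n]` are at most `c`. -/
def cellIncrementsLE {Ω : Type*} (X : ℝ≥0 → Ω → ℝ) (n M k : ℕ) (c : ℝ) : Set Ω :=
  {ω | ∀ j < M, X (((k * M + j + 1 : ℕ) : ℝ≥0) / (n * M : ℕ)) ω -
    X (((k * M + j : ℕ) : ℝ≥0) / (n * M : ℕ)) ω ≤ c}

lemma mem_Ioc_div_iff_ceil {n k : ℕ} (hn : 0 < n) {u : ℝ≥0} :
    u ∈ Ioc ((k : ℝ≥0) / n) (((k + 1 : ℕ) : ℝ≥0) / n) ↔ ⌈u * n⌉₊ = k + 1 := by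
  have hn' : (0 : ℝ≥0) < n := by exact_mod_cast hn
  rw [Nat.ceil_eq_iff (Nat.succ_ne_zero k), mem_Ioc, div_lt_iff₀ hn', le_div_iff₀ hn']
  simp

/-- The slack `c < c'` absorbs the oscillation of the path between its jumps. The converse
direction, `eventually_notMem_cellIncrementsLE`, needs no slack because a violating jump exceeds `c`
strictly. -/
lemma eventually_mem_cellIncrementsLE {Ω : Type*} {X : ℝ≥0 → Ω → ℝ} {n k : ℕ} (hn : 0 < n)
    {c c' : ℝ} (hc : c < c') (hc' : 0 < c') {ω : Ω} (hω : IsCadlagPath (fun t => X t ω))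
    (h : ω ∈ cellJumpsLE X n k c) : ∀ᶠ M in atTop, ω ∈ cellIncrementsLE X n M k c' := by
  obtain ⟨δ, hδ, H⟩ := hω.exists_increment_le hc hc' h
  have h1 : Tendsto (fun M : ℕ => (1 : ℝ) / M) atTop (𝓝 0) := tendsto_one_div_atTop_nhds_zero_nat
  filter_upwards [h1.eventually (gt_mem_nhds hδ), eventually_gt_atTop 0] with M hM hM0 j hj
  have hn' : (0 : ℝ≥0) < n := by exact_mod_cast hn
  have hM' : (0 : ℝ≥0) < M := by exact_mod_cast hM0
  have hnM : (0 : ℝ≥0) < (n * M : ℕ) := by exact_mod_cast Nat.mul_pos hn hM0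
  refine H _ _ ?_ ?_ ?_ ?_
  · rw [div_le_div_iff₀ hn' hnM]
    have : k * (n * M) ≤ (k * M + j) * n := by nlinarith [Nat.zero_le (j * n)]
    exact_mod_cast this
  · exact div_le_div_of_nonneg_right (by exact_mod_cast Nat.le_succ _) zero_le
  · rw [div_le_div_iff₀ hnM hn']
    have : (k * M + j + 1) * n ≤ (k + 1) * (n * M) := by
      calc (k * M + j + 1) * n ≤ (k * M + M) * n := Nat.mul_le_mul_right n (by omega)
        _ = (k + 1) * (n * M) := by ring
    exact_mod_cast this
  · rw [NNReal.dist_eq]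
    have h2 : ((((k * M + j + 1 : ℕ) : ℝ≥0) / (n * M : ℕ) : ℝ≥0) : ℝ) -
        (((k * M + j : ℕ) : ℝ≥0) / (n * M : ℕ) : ℝ≥0) = 1 / (n * M : ℕ) := by
      push_cast
      ring
    rw [h2, abs_of_nonneg (by positivity)]
    refine lt_of_le_of_lt ?_ hM
    have hM1 : (0 : ℝ) < M := by exact_mod_cast hM0
    refine one_div_le_one_div_of_le hM1 ?_
    exact_mod_cast Nat.le_mul_of_pos_left M hn

lemma eventually_notMem_cellIncrementsLE {Ω : Type*} {X : ℝ≥0 → Ω → ℝ} {n k : ℕ} (hn : 0 < n)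
    {c : ℝ} {ω : Ω} (hω : IsCadlagPath (fun t => X t ω))
    (h : ω ∉ cellJumpsLE X n k c) : ∀ᶠ M in atTop, ω ∉ cellIncrementsLE X n M k c := by
  simp only [cellJumpsLE, mem_ofPred_eq, not_forall, not_le] at h
  obtain ⟨u, hu, hc⟩ := h
  obtain ⟨δ, hδ, H⟩ := hω.exists_lt_increment hc
  have h1 : Tendsto (fun M : ℕ => (1 : ℝ) / M) atTop (𝓝 0) := tendsto_one_div_atTop_nhds_zero_nat
  filter_upwards [h1.eventually (gt_mem_nhds hδ), eventually_gt_atTop 0] with M hM hM0 hB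
  have hn' : (0 : ℝ≥0) < n := by exact_mod_cast hn
  have hM' : (0 : ℝ≥0) < M := by exact_mod_cast hM0
  have hnM : (0 : ℝ≥0) < (n * M : ℕ) := by exact_mod_cast Nat.mul_pos hn hM0
  rw [mem_Ioc, div_lt_iff₀ hn', le_div_iff₀ hn'] at hu
  have hlo : k * M < ⌈u * (n * M : ℕ)⌉₊ := by
    rw [Nat.lt_ceil]
    push_cast
    calc (k : ℝ≥0) * M < u * n * M := by gcongr; exact hu.1
      _ = _ := by ring
  have hhi : ⌈u * (n * M : ℕ)⌉₊ ≤ (k + 1) * M := by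
    rw [Nat.ceil_le]
    push_cast
    calc u * (n * M) = u * n * M := by ring
      _ ≤ (k + 1) * M := by gcongr; exact_mod_cast hu.2
  obtain ⟨j, hj⟩ : ∃ j, ⌈u * (n * M : ℕ)⌉₊ = k * M + j + 1 :=
    ⟨⌈u * (n * M : ℕ)⌉₊ - k * M - 1, by omega⟩
  have hjM : j < M := by
    rw [add_mul, one_mul] at hhi
    omega
  have hmem := (mem_Ioc_div_iff_ceil (Nat.mul_pos hn hM0)).2 hj
  refine (hB j hjM).not_gt (H _ _ hmem.1 hmem.2 ?_)
  rw [NNReal.dist_eq]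
  have h2 : ((((k * M + j + 1 : ℕ) : ℝ≥0) / (n * M : ℕ) : ℝ≥0) : ℝ) -
      (((k * M + j : ℕ) : ℝ≥0) / (n * M : ℕ) : ℝ≥0) = 1 / (n * M : ℕ) := by
    push_cast
    ring
  rw [h2, abs_of_nonneg (by positivity)]
  refine lt_of_le_of_lt ?_ hM
  have hM1 : (0 : ℝ) < M := by exact_mod_cast hM0
  refine one_div_le_one_div_of_le hM1 ?_
  exact_mod_cast Nat.le_mul_of_pos_left M hn

/-- Fatou's inequality for the lower limit of the events `B M`. A general filter `F` is allowed so
that limits along an ultrafilter can be used. -/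
lemma measureReal_le_of_eventually_mem {Ω : Type*} [MeasurableSpace Ω] {P : Measure Ω}
    [IsProbabilityMeasure P] {A : Set Ω} {B : ℕ → Set Ω}
    (h : ∀ᵐ ω ∂P, ω ∈ A → ∀ᶠ M in atTop, ω ∈ B M) {F : Filter ℕ} [F.NeBot] (hF : F ≤ atTop)
    {l : ℝ} (hl : Tendsto (fun M => P.real (B M)) F (𝓝 l)) : P.real A ≤ l := by
  have hmono : Monotone fun N => ⋂ M ≥ N, B M := fun N N' hN =>
    biInter_mono (fun M (hM : M ≥ N') => hN.trans hM) fun _ _ => le_rfl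
  have h1 : Tendsto (fun N => P.real (⋂ M ≥ N, B M)) atTop (𝓝 (P.real (⋃ N, ⋂ M ≥ N, B M))) :=
    (ENNReal.tendsto_toReal (measure_ne_top _ _)).comp (tendsto_measure_iUnion_atTop hmono)
  have h2 : P.real A ≤ P.real (⋃ N, ⋂ M ≥ N, B M) := by
    refine ENNReal.toReal_mono (measure_ne_top _ _) (measure_mono_ae ?_)
    filter_upwards [h] with ω hω hA
    obtain ⟨N, hN⟩ := eventually_atTop.1 (hω hA)
    exact mem_iUnion.2 ⟨N, mem_iInter₂.2 hN⟩
  refine h2.trans (le_of_tendsto_of_tendsto' (h1.mono_left hF) hl fun N => ?_)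
  exact measureReal_mono (biInter_subset_of_mem (mem_Ici.2 le_rfl))

lemma le_measureReal_of_eventually_notMem {Ω : Type*} [MeasurableSpace Ω] {P : Measure Ω}
    [IsProbabilityMeasure P] {A : Set Ω} {B : ℕ → Set Ω} (hB : ∀ M, MeasurableSet (B M))
    (h : ∀ᵐ ω ∂P, ω ∉ A → ∀ᶠ M in atTop, ω ∉ B M) {F : Filter ℕ} [F.NeBot] (hF : F ≤ atTop)
    {l : ℝ} (hl : Tendsto (fun M => P.real (B M)) F (𝓝 l)) : l ≤ P.real A := by
  have h1 := measureReal_le_of_eventually_mem (A := Aᶜ) (B := fun M => (B M)ᶜ) h hF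
    (l := 1 - l) (by
      simp_rw [probReal_compl_eq_one_sub (hB _)]
      exact hl.const_sub 1)
  have h2 : P.real (A ∪ Aᶜ) ≤ P.real A + P.real Aᶜ := measureReal_union_le _ _
  rw [union_compl_self, probReal_univ] at h2
  linarith

/-! ### Independence of the jumps in disjoint cells -/

namespace IsLevyProcess

variable {Ω : Type*} [MeasurableSpace Ω] {P : Measure Ω}
  {X : ℝ≥0 → Ω → ℝ}

lemma measurableSet_cellIncrementsLE (hX : IsLevyProcess X P) (n M k : ℕ) (c : ℝ) :
    MeasurableSet (cellIncrementsLE X n M k c) := by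
  have : cellIncrementsLE X n M k c = ⋂ j, ⋂ (_ : j < M),
      {ω | X (((k * M + j + 1 : ℕ) : ℝ≥0) / (n * M : ℕ)) ω -
        X (((k * M + j : ℕ) : ℝ≥0) / (n * M : ℕ)) ω ≤ c} := by
    ext; simp [cellIncrementsLE]
  rw [this]
  exact MeasurableSet.iInter fun j => MeasurableSet.iInter fun _ =>
    measurableSet_le ((hX.measurable _).sub (hX.measurable _)) measurable_const

lemma measure_increment_le (hX : IsLevyProcess X P) (N i : ℕ) (c : ℝ) :
    P.real {ω | X (((i + 1 : ℕ) : ℝ≥0) / N) ω - X ((i : ℝ≥0) / N) ω ≤ c} =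
      P.real {ω | X (1 / N) ω - X 0 ω ≤ c} := by
  have h := (hX.stationary_increments ((i : ℝ≥0) / N) (1 / N)).measure_mem_eq
    (measurableSet_Iic (a := c))
  have e : ((i + 1 : ℕ) : ℝ≥0) / N = (i : ℝ≥0) / N + 1 / N := by push_cast; ring
  rw [e]
  exact congrArg ENNReal.toReal h

/-- The event involves uncountably many times. On càdlàg paths it coincides with a countable
combination of increment events, with slacks `1 / (i + 1)`. -/
lemma nullMeasurableSet_cellJumpsLE (hX : IsLevyProcess X P) {n : ℕ} (hn : 0 < n) (k : ℕ) {c : ℝ}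
    (hc : 0 ≤ c) : NullMeasurableSet (cellJumpsLE X n k c) P := by
  have hm : MeasurableSet (⋂ i : ℕ, ⋃ N : ℕ, ⋂ M ≥ N,
      cellIncrementsLE X n M k (c + 1 / ((i : ℝ) + 1))) :=
    MeasurableSet.iInter fun i => MeasurableSet.iUnion fun N => MeasurableSet.iInter fun M =>
      MeasurableSet.iInter fun _ => hX.measurableSet_cellIncrementsLE _ _ _ _
  refine hm.nullMeasurableSet.congr ?_
  filter_upwards [hX.cadlag] with ω hω
  refine propext ⟨fun h => ?_, fun h => ?_⟩
  · have h' : ∀ i : ℕ, ω ∈ cellJumpsLE X n k (c + 1 / ((i : ℝ) + 1)) := by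
      intro i
      by_contra hcon
      have h1 := eventually_notMem_cellIncrementsLE hn hω hcon
      obtain ⟨N, hN⟩ := mem_iUnion.1 (mem_iInter.1 h i)
      obtain ⟨N', hN'⟩ := eventually_atTop.1 h1
      exact hN' (max N N') (le_max_right _ _)
        (mem_iInter₂.1 hN (max N N') (le_max_left _ _))
    intro u hu
    refine ge_of_tendsto' (b := pathJump _ u) (x := atTop) ?_ fun i : ℕ => h' i u hu
    simpa using (tendsto_one_div_add_atTop_nhds_zero_nat (𝕜 := ℝ)).const_add c
  · refine mem_iInter.2 fun i => ?_
    have hi : 0 < 1 / ((i : ℝ) + 1) := by positivity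
    obtain ⟨N, hN⟩ := eventually_atTop.1
      (eventually_mem_cellIncrementsLE (k := k) hn (lt_add_of_pos_right c hi) (by linarith) hω h)
    exact mem_iUnion.2 ⟨N, mem_iInter₂.2 hN⟩

variable [IsProbabilityMeasure P]

/-- All cells are cut by one grid of mesh `1 / (n M)`, whose increments are independent and
identically distributed; the increment of index `i` belongs to the cell `i / M`. -/
lemma measure_biInter_cellIncrementsLE_eq_pow (hX : IsLevyProcess X P) (n M : ℕ)
    (K : Finset ℕ) (c : ℕ → ℝ) :
    P.real (⋂ k ∈ K, cellIncrementsLE X n M k (c k)) =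
      ∏ k ∈ K, P.real {ω | X (1 / (n * M : ℕ)) ω - X 0 ω ≤ c k} ^ M := by
  rcases Nat.eq_zero_or_pos M with rfl | hM
  · have : (⋂ k ∈ K, cellIncrementsLE X n 0 k (c k)) = univ := by
      ext; simp [cellIncrementsLE]
    simp [this]
  have hind := hX.indep_increments.nat (t := fun i : ℕ => (i : ℝ≥0) / (n * M : ℕ))
    (fun i j hij => by dsimp only; gcongr)
  have hmul : ∀ p ∈ K ×ˢ Finset.range M, (p.1 * M + p.2) / M = p.1 := by
    intro p hp
    have := Finset.mem_range.1 (Finset.mem_product.1 hp).2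
    rw [mul_comm, Nat.mul_add_div hM, Nat.div_eq_of_lt this, add_zero]
  have hinj : Set.InjOn (fun p : ℕ × ℕ => p.1 * M + p.2) (K ×ˢ Finset.range M : Finset (ℕ × ℕ)) := by
    intro p hp p' hp' h
    dsimp only at h
    have h1 : p.1 = p'.1 := by rw [← hmul p hp, h, hmul p' hp']
    rw [h1] at h
    exact Prod.ext h1 (by omega)
  have h := hind.measure_inter_preimage_eq_mul
    ((K ×ˢ Finset.range M).image fun p : ℕ × ℕ => p.1 * M + p.2)
    (sets := fun i => Iic (c (i / M))) fun _ _ => measurableSet_Iic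
  have hset : (⋂ k ∈ K, cellIncrementsLE X n M k (c k)) =
      ⋂ i ∈ (K ×ˢ Finset.range M).image fun p : ℕ × ℕ => p.1 * M + p.2,
        (fun ω => X (((i + 1 : ℕ) : ℝ≥0) / (n * M : ℕ)) ω - X ((i : ℝ≥0) / (n * M : ℕ)) ω) ⁻¹'
          Iic (c (i / M)) := by
    ext ω
    simp only [mem_iInter, Finset.mem_image, cellIncrementsLE, mem_ofPred_eq, mem_preimage, mem_Iic]
    constructor
    · rintro H _ ⟨p, hp, rfl⟩
      rw [hmul p hp]
      exact H p.1 (Finset.mem_product.1 hp).1 p.2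
        (Finset.mem_range.1 (Finset.mem_product.1 hp).2)
    · intro H k hk j hj
      have hp : (k, j) ∈ K ×ˢ Finset.range M :=
        Finset.mem_product.2 ⟨hk, Finset.mem_range.2 hj⟩
      have := H _ ⟨(k, j), hp, rfl⟩
      rwa [hmul _ hp] at this
  rw [hset, Measure.real, h, ENNReal.toReal_prod, Finset.prod_image hinj, Finset.prod_product]
  refine Finset.prod_congr rfl fun k hk => ?_
  rw [← Finset.card_range M, ← Finset.prod_const, Finset.card_range]
  refine Finset.prod_congr rfl fun j hj => ?_
  rw [hmul (k, j) (Finset.mem_product.2 ⟨hk, hj⟩)]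
  exact hX.measure_increment_le (n * M) (k * M + j) (c k)

lemma measure_biInter_cellIncrementsLE (hX : IsLevyProcess X P) (n M : ℕ)
    (K : Finset ℕ) (c : ℕ → ℝ) :
    P.real (⋂ k ∈ K, cellIncrementsLE X n M k (c k)) =
      ∏ k ∈ K, P.real (cellIncrementsLE X n M 0 (c k)) := by
  rw [hX.measure_biInter_cellIncrementsLE_eq_pow]
  refine Finset.prod_congr rfl fun k _ => ?_
  have := hX.measure_biInter_cellIncrementsLE_eq_pow n M {0} (fun _ => c k)
  simpa using this.symm

lemma tendsto_measure_biInter_cellJumpsLE (hX : IsLevyProcess X P) {n : ℕ} (hn : 0 < n)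
    (K : Finset ℕ) {c : ℕ → ℝ} (hc : ∀ k, 0 ≤ c k) :
    Tendsto (fun i : ℕ => P.real (⋂ k ∈ K, cellJumpsLE X n k (c k + 1 / ((i : ℝ) + 1)))) atTop
      (𝓝 (P.real (⋂ k ∈ K, cellJumpsLE X n k (c k)))) := by
  have hset : (⋂ k ∈ K, cellJumpsLE X n k (c k)) =
      ⋂ i : ℕ, ⋂ k ∈ K, cellJumpsLE X n k (c k + 1 / ((i : ℝ) + 1)) := by
    ext ω
    simp only [mem_iInter, cellJumpsLE, mem_ofPred_eq]
    constructor
    · intro h i k hk u hu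
      have : 0 ≤ 1 / ((i : ℝ) + 1) := by positivity
      linarith [h k hk u hu]
    · intro h k hk u hu
      refine ge_of_tendsto' (b := pathJump _ u) (x := atTop) ?_ fun i : ℕ => h i k hk u hu
      simpa using (tendsto_one_div_add_atTop_nhds_zero_nat (𝕜 := ℝ)).const_add (c k)
  rw [hset]
  refine (ENNReal.tendsto_toReal (measure_ne_top _ _)).comp (tendsto_measure_iInter_atTop ?_ ?_ ?_)
  · intro i
    refine Finset.nullMeasurableSet_biInter _ fun k _ => ?_
    have : 0 ≤ 1 / ((i : ℝ) + 1) := by positivity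
    exact hX.nullMeasurableSet_cellJumpsLE hn k (by linarith [hc k])
  · intro i j hij ω hω
    simp only [mem_iInter, cellJumpsLE, mem_ofPred_eq] at hω ⊢
    intro k hk u hu
    refine (hω k hk u hu).trans ?_
    gcongr
  · exact ⟨0, measure_ne_top _ _⟩

/-- Jumps over disjoint cells are independent and identically distributed. -/
theorem measure_biInter_cellJumpsLE (hX : IsLevyProcess X P) {n : ℕ} (hn : 0 < n)
    (K : Finset ℕ) {c : ℕ → ℝ} (hc : ∀ k, 0 ≤ c k) :
    P.real (⋂ k ∈ K, cellJumpsLE X n k (c k)) = ∏ k ∈ K, P.real (cellJumpsLE X n 0 (c k)) := by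
  -- Convergence of the increment probabilities as `M → ∞` is not known; compactness of `[0, 1]`
  -- provides a limit `q c` along an ultrafilter, and `q` is sandwiched between jump probabilities.
  have hF : (hyperfilter ℕ : Filter ℕ) ≤ atTop := Nat.hyperfilter_le_atTop
  have hlim : ∀ c : ℝ, ∃ l, Tendsto (fun M => P.real (cellIncrementsLE X n M 0 c))
      (hyperfilter ℕ) (𝓝 l) := by
    intro c
    obtain ⟨l, -, hl⟩ := (isCompact_Icc (a := (0 : ℝ)) (b := 1)).ultrafilter_le_nhds
      ((hyperfilter ℕ).map fun M => P.real (cellIncrementsLE X n M 0 c))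
      (tendsto_principal.2 (Eventually.of_forall fun M => ⟨measureReal_nonneg, measureReal_le_one⟩))
    exact ⟨l, hl⟩
  choose q hq using hlim
  have hqK : ∀ (K : Finset ℕ) (c : ℕ → ℝ), Tendsto
      (fun M => P.real (⋂ k ∈ K, cellIncrementsLE X n M k (c k))) (hyperfilter ℕ)
      (𝓝 (∏ k ∈ K, q (c k))) := by
    intro K c
    simp_rw [hX.measure_biInter_cellIncrementsLE]
    exact tendsto_finsetProd _ fun k _ => hq (c k)
  have upper : ∀ (K : Finset ℕ) (c c' : ℕ → ℝ), (∀ k, c k < c' k) → (∀ k, 0 < c' k) →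
      P.real (⋂ k ∈ K, cellJumpsLE X n k (c k)) ≤ ∏ k ∈ K, q (c' k) := by
    intro K c c' h1 h2
    refine measureReal_le_of_eventually_mem ?_ hF (hqK K c')
    filter_upwards [hX.cadlag] with ω hω hA
    simp only [mem_iInter] at hA ⊢
    exact (eventually_all_finset K).2 fun k hk =>
      eventually_mem_cellIncrementsLE hn (h1 k) (h2 k) hω (hA k hk)
  have lower : ∀ (K : Finset ℕ) (c : ℕ → ℝ),
      ∏ k ∈ K, q (c k) ≤ P.real (⋂ k ∈ K, cellJumpsLE X n k (c k)) := by
    intro K c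
    refine le_measureReal_of_eventually_notMem (fun M => Finset.measurableSet_biInter _ fun k _ =>
      hX.measurableSet_cellIncrementsLE n M k (c k)) ?_ hF (hqK K c)
    filter_upwards [hX.cadlag] with ω hω hA
    simp only [mem_iInter, not_forall] at hA ⊢
    obtain ⟨k, hk, hA⟩ := hA
    filter_upwards [eventually_notMem_cellIncrementsLE hn hω hA] with M hM
    exact ⟨k, hk, hM⟩
  have hq0 : ∀ c, 0 ≤ q c := fun c => ge_of_tendsto' (hq c) fun _ => measureReal_nonneg
  have upper1 : ∀ c c' : ℝ, c < c' → 0 < c' → P.real (cellJumpsLE X n 0 c) ≤ q c' := by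
    intro c c' h1 h2
    simpa using upper {0} (fun _ => c) (fun _ => c') (fun _ => h1) (fun _ => h2)
  have lower1 : ∀ c : ℝ, q c ≤ P.real (cellJumpsLE X n 0 c) := by
    intro c
    simpa using lower {0} (fun _ => c)
  have hpos : ∀ i : ℕ, 0 < 1 / ((i : ℝ) + 1) := fun i => by positivity
  apply le_antisymm
  · have h1 : Tendsto (fun i : ℕ => ∏ k ∈ K, P.real (cellJumpsLE X n 0 (c k + 1 / ((i : ℝ) + 1))))
        atTop (𝓝 (∏ k ∈ K, P.real (cellJumpsLE X n 0 (c k)))) := by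
      refine tendsto_finsetProd _ fun k _ => ?_
      simpa using hX.tendsto_measure_biInter_cellJumpsLE hn {0} (c := fun _ => c k) fun _ => hc k
    refine ge_of_tendsto' h1 fun i => ?_
    refine (upper K c (fun k => c k + 1 / ((i : ℝ) + 1)) (fun k => lt_add_of_pos_right _ (hpos i))
      (fun k => by linarith [hc k, hpos i])).trans ?_
    exact Finset.prod_le_prod (fun k _ => hq0 _) fun k _ => lower1 _
  · refine ge_of_tendsto' (hX.tendsto_measure_biInter_cellJumpsLE hn K hc) fun i => ?_
    refine le_trans ?_ (lower K (fun k => c k + 1 / ((i : ℝ) + 1)))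
    exact Finset.prod_le_prod (fun k _ => measureReal_nonneg) fun k _ =>
      upper1 _ _ (lt_add_of_pos_right _ (hpos i)) (by linarith [hc k, hpos i])

end IsLevyProcess

/-! ### Counting jumps through cells, and the exponential law -/

lemma eventually_ceil_mul_injective (u v : ℝ≥0) :
    ∀ᶠ n : ℕ in atTop, ⌈u * n⌉₊ = ⌈v * n⌉₊ → u = v := by
  rcases eq_or_ne u v with rfl | huv
  · exact Eventually.of_forall fun _ _ => rfl
  have hd : 0 < dist u v := dist_pos.2 huv
  obtain ⟨N, hN⟩ := exists_nat_gt (1 / dist u v)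
  filter_upwards [eventually_ge_atTop N] with n hn h
  have hn1 : 1 < dist u v * n := by
    rw [div_lt_iff₀ hd] at hN
    have : (N : ℝ) ≤ n := by exact_mod_cast hn
    nlinarith
  have key : ∀ u v : ℝ≥0, ⌈u * n⌉₊ = ⌈v * n⌉₊ → (u : ℝ) * n < v * n + 1 := by
    intro u v h
    have h1 : u * n ≤ (⌈v * n⌉₊ : ℝ≥0) := h ▸ Nat.le_ceil _
    have h2 : (⌈v * n⌉₊ : ℝ≥0) < v * n + 1 := Nat.ceil_lt_add_one zero_le
    exact_mod_cast h1.trans_lt h2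
  have h1 := key u v h
  have h2 := key v u h.symm
  have h3 : |(u : ℝ) - v| * n < 1 := by
    rcases abs_cases ((u : ℝ) - v) with h | h <;> rw [h.1] <;> linarith
  rw [NNReal.dist_eq] at hn1
  linarith

/-- The number of cells of a regular grid hit by a set converges to the cardinality of the set. -/
lemma tendsto_encard_image_ceil (S : Set ℝ≥0) :
    Tendsto (fun n : ℕ => (((fun u : ℝ≥0 => ⌈u * n⌉₊) '' S).encard : ℝ≥0∞)) atTop
      (𝓝 (S.encard : ℝ≥0∞)) := by
  refine (ENat.continuous_toENNReal.tendsto _).comp ?_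
  refine tendsto_order.2 ⟨fun a ha => ?_, fun a ha =>
    Eventually.of_forall fun n => (encard_image_le _ _).trans_lt ha⟩
  obtain ⟨m, rfl⟩ := ENat.ne_top_iff_exists.1 ha.ne_top
  -- The cardinality may be infinite, so `m + 1` points are selected; a fine grid puts them in
  -- distinct cells.
  obtain ⟨T, hTS, hT⟩ := exists_subset_encard_eq (Order.add_one_le_of_lt ha)
  have hfin : T.Finite := finite_of_encard_eq_coe (k := m + 1) (by rw [hT]; rfl)
  have h1 : ∀ᶠ n : ℕ in atTop, ∀ u ∈ T, ∀ v ∈ T, ⌈u * n⌉₊ = ⌈v * n⌉₊ → u = v :=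
    (eventually_all_finite hfin).2 fun u _ => (eventually_all_finite hfin).2 fun v _ =>
      eventually_ceil_mul_injective u v
  filter_upwards [h1] with n hn
  have hinj : InjOn (fun u : ℝ≥0 => ⌈u * n⌉₊) T := fun u hu v hv h => hn u hu v hv h
  calc (m : ℕ∞) < m + 1 := by exact_mod_cast Nat.lt_succ_self m
    _ = ((fun u : ℝ≥0 => ⌈u * n⌉₊) '' T).encard := by rw [hinj.encard_image, hT]
    _ ≤ _ := encard_le_encard (image_mono hTS)

/-- The half-open cell of index `k` is the set where `⌈u * n⌉₊ = k + 1`, hence the shift by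
`Nat.succ`. -/
lemma sum_indicator_compl_cellJumpsLE {Ω : Type*} (X : ℝ≥0 → Ω → ℝ) {n : ℕ} (hn : 0 < n)
    (c : ℝ) (ω : Ω) :
    ∑ k ∈ Finset.range n, (cellJumpsLE X n k c)ᶜ.indicator (1 : Ω → ℝ≥0∞) ω =
      (((fun u : ℝ≥0 => ⌈u * n⌉₊) ''
        {s : ℝ≥0 | s ∈ Ioc 0 1 ∧ pathJump (fun t => X t ω) s ∈ Ioi c}).encard : ℝ≥0∞) := by
  classical
  have himg : ((fun u : ℝ≥0 => ⌈u * n⌉₊) ''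
      {s : ℝ≥0 | s ∈ Ioc 0 1 ∧ pathJump (fun t => X t ω) s ∈ Ioi c}) =
      Nat.succ '' ((Finset.range n).filter fun k => ω ∈ (cellJumpsLE X n k c)ᶜ : Finset ℕ) := by
    ext i
    simp only [mem_image, Finset.coe_filter, Finset.mem_range, mem_ofPred_eq, mem_compl_iff,
      cellJumpsLE, not_forall, not_le, mem_Ioi, exists_prop]
    constructor
    · rintro ⟨u, ⟨hu, hc⟩, rfl⟩
      have h0 : 0 < ⌈u * n⌉₊ := Nat.ceil_pos.2 (mul_pos hu.1 (by exact_mod_cast hn))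
      obtain ⟨k, hk⟩ := Nat.exists_eq_succ_of_ne_zero h0.ne'
      refine ⟨k, ⟨?_, u, (mem_Ioc_div_iff_ceil hn).2 hk, hc⟩, hk.symm⟩
      have : ⌈u * n⌉₊ ≤ n := Nat.ceil_le.2 (mul_le_of_le_one_left zero_le hu.2)
      omega
    · rintro ⟨k, ⟨hkn, u, hu, hc⟩, rfl⟩
      refine ⟨u, ⟨⟨zero_le.trans_lt hu.1, hu.2.trans ?_⟩, hc⟩, (mem_Ioc_div_iff_ceil hn).1 hu⟩
      have hn' : (0 : ℝ≥0) < n := by exact_mod_cast hn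
      rw [div_le_one hn']
      exact_mod_cast hkn
  rw [himg, Nat.succ_injective.encard_image, encard_coe_eq_coe_finsetCard, ENat.toENNReal_coe,
    Finset.card_filter, Nat.cast_sum]
  refine Finset.sum_congr rfl fun k _ => ?_
  rw [indicator_apply]
  split_ifs <;> simp

namespace IsLevyProcess

variable {Ω : Type*} [MeasurableSpace Ω] {P : Measure Ω} [IsProbabilityMeasure P]
  {X : ℝ≥0 → Ω → ℝ}

lemma measure_cellJumpsLE_eq (hX : IsLevyProcess X P) {n : ℕ} (hn : 0 < n) (k : ℕ) {c : ℝ}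
    (hc : 0 ≤ c) : P.real (cellJumpsLE X n k c) = P.real (cellJumpsLE X n 0 c) := by
  simpa using hX.measure_biInter_cellJumpsLE hn {k} (c := fun _ => c) fun _ => hc

lemma measure_cellJumpsLE_pow (hX : IsLevyProcess X P) {n : ℕ} (hn : 0 < n) {c : ℝ}
    (hc : 0 ≤ c) : P.real (cellJumpsLE X n 0 c) ^ n = P.real (cellJumpsLE X 1 0 c) := by
  have h := hX.measure_biInter_cellJumpsLE hn (Finset.range n) (c := fun _ => c) fun _ => hc
  rw [Finset.prod_const, Finset.card_range] at h
  rw [← h]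
  congr 1
  ext ω
  simp only [mem_iInter, cellJumpsLE, mem_ofPred_eq, Finset.mem_range]
  have hn' : (0 : ℝ≥0) < n := by exact_mod_cast hn
  constructor
  · intro H u hu
    simp only [Nat.cast_zero, Nat.cast_one, zero_add, div_one] at hu
    have h0 : 0 < ⌈u * n⌉₊ := Nat.ceil_pos.2 (mul_pos (by simpa using hu.1) hn')
    obtain ⟨k, hk⟩ := Nat.exists_eq_succ_of_ne_zero h0.ne'
    refine H k ?_ u ((mem_Ioc_div_iff_ceil hn).2 hk)
    have : ⌈u * n⌉₊ ≤ n := Nat.ceil_le.2 (mul_le_of_le_one_left zero_le hu.2)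
    omega
  · intro H k hk u hu
    refine H u ⟨by simpa using zero_le.trans_lt hu.1, hu.2.trans ?_⟩
    simp only [Nat.cast_one, zero_add, div_one]
    rw [div_le_one hn']
    exact_mod_cast hk

/-- The number of jumps larger than `c` in a time interval of length `1 / n` is zero with
probability `exp (-Λ (c, ∞) / n)`. -/
theorem measure_cellJumpsLE (hX : IsLevyProcess X P) {Λ : Measure ℝ} (hΛ : IsLevyMeasure X P Λ)
    {c : ℝ} (hc : 0 ≤ c) (hfin : Λ (Ioi c) ≠ ∞) {n : ℕ} (hn : 0 < n) :
    P.real (cellJumpsLE X n 0 c) = Real.exp (-((Λ (Ioi c)).toReal / n)) := by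
  have hL := hΛ.2 (Ioi c) measurableSet_Ioi (notMem_Ioi.2 hc)
  have hnull : ∀ n, ∀ k ∈ Finset.range n, NullMeasurableSet (cellJumpsLE X n k c)ᶜ P :=
    fun n k hk => (hX.nullMeasurableSet_cellJumpsLE
      ((Nat.zero_le k).trans_lt (Finset.mem_range.1 hk)) k hc).compl
  -- The number of cells hit is dominated by the number of jumps above `c`, whose expectation is the
  -- finite `Λ (Ioi c)`.
  have hlim := tendsto_lintegral_of_dominated_convergence' (μ := P)
    (F := fun n ω => ∑ k ∈ Finset.range n, (cellJumpsLE X n k c)ᶜ.indicator (1 : Ω → ℝ≥0∞) ω)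
    (fun ω => ({s : ℝ≥0 | s ∈ Ioc 0 1 ∧ pathJump (fun t => X t ω) s ∈ Ioi c}.encard : ℝ≥0∞))
    (fun n => Finset.aemeasurable_fun_sum _ fun k hk =>
      aemeasurable_one.indicator₀ (hnull n k hk))
    (fun n => Eventually.of_forall fun ω => by
      dsimp only
      rcases Nat.eq_zero_or_pos n with rfl | hn
      · simp
      rw [sum_indicator_compl_cellJumpsLE X hn]
      exact ENat.toENNReal_le.2 (encard_image_le _ _))
    (by rwa [← hL])
    (Eventually.of_forall fun ω => by
      refine (tendsto_encard_image_ceil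
        {s : ℝ≥0 | s ∈ Ioc 0 1 ∧ pathJump (fun t => X t ω) s ∈ Ioi c}).congr' ?_
      filter_upwards [eventually_gt_atTop 0] with n hn
      exact (sum_indicator_compl_cellJumpsLE X hn c ω).symm)
  rw [← hL] at hlim
  have hlim' := (ENNReal.tendsto_toReal hfin).comp hlim
  have hint : ∀ n : ℕ, (∫⁻ ω, ∑ k ∈ Finset.range n,
      (cellJumpsLE X n k c)ᶜ.indicator (1 : Ω → ℝ≥0∞) ω ∂P).toReal =
      n * (1 - P.real (cellJumpsLE X n 0 c)) := by
    intro n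
    have hsum := lintegral_finsetSum' (μ := P) (Finset.range n)
      (f := fun k => (cellJumpsLE X n k c)ᶜ.indicator (1 : Ω → ℝ≥0∞))
      fun k hk => aemeasurable_one.indicator₀ (hnull n k hk)
    rw [hsum, ENNReal.toReal_sum fun k hk => by
        rw [lintegral_indicator_one₀ (hnull n k hk)]; exact measure_ne_top _ _]
    rw [Finset.sum_congr rfl fun k hk => ?_, Finset.sum_const, Finset.card_range, nsmul_eq_mul]
    have hn0 : 0 < n := (Nat.zero_le k).trans_lt (Finset.mem_range.1 hk)
    rw [lintegral_indicator_one₀ (hnull n k hk), ← hX.measure_cellJumpsLE_eq hn0 k hc]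
    exact probReal_compl_eq_one_sub₀ (hX.nullMeasurableSet_cellJumpsLE hn0 k hc)
  have h1 : Tendsto (fun n : ℕ => (n : ℝ) * (P.real (cellJumpsLE X n 0 c) - 1)) atTop
      (𝓝 (-(Λ (Ioi c)).toReal)) := by
    refine hlim'.neg.congr fun n => ?_
    rw [Function.comp_apply, hint]
    ring
  -- The powers `(1 + (p_n - 1))^n` converge to `exp (-Λ (Ioi c))`, yet `p_n^n` does not depend on
  -- `n`.
  have h2 := Real.tendsto_one_add_pow_exp_of_tendsto h1
  have h3 : P.real (cellJumpsLE X 1 0 c) = Real.exp (-(Λ (Ioi c)).toReal) := by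
    refine tendsto_nhds_unique (tendsto_const_nhds.congr' ?_) h2
    filter_upwards [eventually_gt_atTop 0] with m hm
    rw [add_sub_cancel, hX.measure_cellJumpsLE_pow hm hc]
  rw [← hX.measure_cellJumpsLE_pow hn hc] at h3
  have hn' : (n : ℝ) ≠ 0 := by exact_mod_cast hn.ne'
  refine (pow_left_inj₀ measureReal_nonneg (Real.exp_pos _).le hn.ne').1 ?_
  rw [h3, ← Real.exp_nat_mul]
  congr 1
  field_simp

end IsLevyProcess

/-! ### From constant levels to monotone barriers -/

/-- An antitone function and its Riemann sums over the regular grid of `[0, 1]`. -/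
lemma Antitone.riemannSum_bounds {F : ℝ → ℝ} (hF : Antitone F) {n : ℕ} (hn : 0 < n) :
    (∑ k ∈ Finset.range n, F ((k + 1 : ℕ) / n)) / n ≤ ∫ u in (0 : ℝ)..1, F u ∧
      ∫ u in (0 : ℝ)..1, F u ≤ (∑ k ∈ Finset.range n, F (k / n)) / n := by
  have hn' : (0 : ℝ) < n := by exact_mod_cast hn
  have hanti : Antitone fun x : ℝ => F (x / n) := fun x y h => hF (by gcongr)
  have hint : ∫ x in (0 : ℝ)..(0 + n), F (x / n) = n * ∫ u in (0 : ℝ)..1, F u := by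
    rw [intervalIntegral.integral_comp_div _ hn'.ne', zero_add, zero_div, div_self hn'.ne',
      smul_eq_mul]
  have h1 := AntitoneOn.sum_le_integral (x₀ := 0) (a := n) (hanti.antitoneOn _)
  have h2 := AntitoneOn.integral_le_sum (x₀ := 0) (a := n) (hanti.antitoneOn _)
  rw [hint] at h1 h2
  simp only [zero_add] at h1 h2
  rw [div_le_iff₀' hn', le_div_iff₀' hn']
  exact ⟨h1, h2⟩

lemma antitone_measureReal_Ioi {Λ : Measure ℝ} (hfin : ∀ c : ℝ, 0 < c → Λ (Ioi c) ≠ ∞) :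
    AntitoneOn (fun c => (Λ (Ioi c)).toReal) (Ioi 0) := fun c hc _ _ h =>
  ENNReal.toReal_mono (hfin c hc) (measure_mono (Ioi_subset_Ioi h))

namespace IsLevyProcess

variable {Ω : Type*} [MeasurableSpace Ω] {P : Measure Ω} [IsProbabilityMeasure P]
  {X : ℝ≥0 → Ω → ℝ}

/-- The probability that the jumps stay below a nondecreasing barrier. -/
theorem measure_jumps_le_barrier (hX : IsLevyProcess X P) {Λ : Measure ℝ}
    (hΛ : IsLevyMeasure X P Λ) (hfin : ∀ c : ℝ, 0 < c → Λ (Ioi c) ≠ ∞) {b : ℝ → ℝ}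
    (hb : Monotone b) (hpos : ∀ u, 0 < b u) :
    P.real {ω | ∀ u ∈ Ioc (0 : ℝ≥0) 1, pathJump (fun t => X t ω) u ≤ b u} =
      Real.exp (-∫ u in (0 : ℝ)..1, (Λ (Ioi (b u))).toReal) := by
  set F : ℝ → ℝ := fun u => (Λ (Ioi (b u))).toReal with hFdef
  have hF : Antitone F := fun u v h =>
    antitone_measureReal_Ioi hfin (hpos u) (hpos v) (hb h)
  have hprob : ∀ n : ℕ, 0 < n → ∀ g : ℕ → ℝ,
      P.real (⋂ k ∈ Finset.range n, cellJumpsLE X n k (b (g k))) =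
        Real.exp (-((∑ k ∈ Finset.range n, F (g k)) / n)) := by
    intro n hn g
    rw [hX.measure_biInter_cellJumpsLE hn _ fun k => (hpos _).le, Finset.sum_div,
      ← Finset.sum_neg_distrib, Real.exp_sum]
    exact Finset.prod_congr rfl fun k _ =>
      hX.measure_cellJumpsLE hΛ (hpos _).le (hfin _ (hpos _)) hn
  set A := {ω | ∀ u ∈ Ioc (0 : ℝ≥0) 1, pathJump (fun t => X t ω) u ≤ b u}
  have hlow : ∀ n : ℕ, 0 < n →
      Real.exp (-((∑ k ∈ Finset.range n, F (k / n)) / n)) ≤ P.real A := by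
    intro n hn
    rw [← hprob n hn fun k => k / n]
    refine measureReal_mono fun ω hω u hu => ?_
    have hn' : (0 : ℝ≥0) < n := by exact_mod_cast hn
    have h0 : 0 < ⌈u * n⌉₊ := Nat.ceil_pos.2 (mul_pos hu.1 hn')
    obtain ⟨k, hk⟩ := Nat.exists_eq_succ_of_ne_zero h0.ne'
    have hkn : k < n := by
      have : ⌈u * n⌉₊ ≤ n := Nat.ceil_le.2 (mul_le_of_le_one_left zero_le hu.2)
      omega
    have hmem := (mem_Ioc_div_iff_ceil hn).2 hk
    refine (mem_iInter₂.1 hω k (Finset.mem_range.2 hkn) u hmem).trans (hb ?_)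
    exact_mod_cast hmem.1.le
  have hup : ∀ n : ℕ, 0 < n →
      P.real A ≤ Real.exp (-((∑ k ∈ Finset.range n, F ((k + 1 : ℕ) / n)) / n)) := by
    intro n hn
    rw [← hprob n hn fun k => (k + 1 : ℕ) / n]
    refine measureReal_mono fun ω hω => mem_iInter₂.2 fun k hk u hu => ?_
    have hn' : (0 : ℝ≥0) < n := by exact_mod_cast hn
    refine (hω u ⟨zero_le.trans_lt hu.1, hu.2.trans ?_⟩).trans (hb ?_)
    · rw [div_le_one hn']
      exact_mod_cast Finset.mem_range.1 hk
    · exact_mod_cast NNReal.coe_le_coe.2 hu.2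
  -- By telescoping, the left and right Riemann sums differ by `(F 0 - F 1) / n`, so both bounds
  -- converge to the integral.
  have hdiff : ∀ n : ℕ, 0 < n → (∑ k ∈ Finset.range n, F (k / n)) / n -
      (∑ k ∈ Finset.range n, F ((k + 1 : ℕ) / n)) / n = (F 0 - F 1) / n := by
    intro n hn
    have hn' : (n : ℝ) ≠ 0 := by exact_mod_cast hn.ne'
    rw [← sub_div, ← Finset.sum_sub_distrib,
      Finset.sum_range_sub' (fun k : ℕ => F ((k : ℝ) / n)), Nat.cast_zero, zero_div, div_self hn']
  set I := ∫ u in (0 : ℝ)..1, F u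
  have hz : Tendsto (fun n : ℕ => (F 0 - F 1) / n) atTop (𝓝 0) :=
    tendsto_const_div_atTop_nhds_zero_nat _
  apply le_antisymm
  · have h1 : Tendsto (fun n : ℕ => Real.exp (-(I - (F 0 - F 1) / n))) atTop
        (𝓝 (Real.exp (-I))) := by
      simpa [Function.comp_def] using (Real.continuous_exp.tendsto _).comp (hz.const_sub I).neg
    refine ge_of_tendsto h1 ?_
    filter_upwards [eventually_gt_atTop 0] with n hn
    refine (hup n hn).trans (Real.exp_le_exp.2 ?_)
    linarith [hdiff n hn, (hF.riemannSum_bounds hn).2]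
  · have h1 : Tendsto (fun n : ℕ => Real.exp (-(I + (F 0 - F 1) / n))) atTop
        (𝓝 (Real.exp (-I))) := by
      simpa [Function.comp_def] using (Real.continuous_exp.tendsto _).comp (hz.const_add I).neg
    refine le_of_tendsto h1 ?_
    filter_upwards [eventually_gt_atTop 0] with n hn
    refine le_trans (Real.exp_le_exp.2 ?_) (hlow n hn)
    linarith [hdiff n hn, (hF.riemannSum_bounds hn).1]

end IsLevyProcess

/-! ### Super-slow variation at arbitrary logarithmic powers -/

/-- `ℓ (b / y) / ℓ b → 1` as `b → 0`, uniformly in `1 ≤ y ≤ (-log b) ^ D`. -/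
def LogUniformlySlowlyVarying (ℓ : ℝ → ℝ) (D : ℝ) : Prop :=
  ∀ ε > 0, ∃ β > 0, ∀ b, 0 < b → b < β → 0 < ℓ b ∧ ∀ y, 1 ≤ y → y ≤ (-Real.log b) ^ D →
    |ℓ (b / y) / ℓ b - 1| ≤ ε

lemma exists_forall_of_eventually_nhdsGT_zero {p : ℝ → Prop} (h : ∀ᶠ b in 𝓝[>] (0 : ℝ), p b) :
    ∃ β > 0, ∀ b, 0 < b → b < β → p b := by
  obtain ⟨β, hβ, H⟩ := mem_nhdsGT_iff_exists_Ioo_subset.1 h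
  exact ⟨β, hβ, fun b h1 h2 => H ⟨h1, h2⟩⟩

lemma neg_log_gt_of_lt_exp {b C : ℝ} (hb : 0 < b) (h : b < Real.exp (-C)) : C < -Real.log b := by
  have := (Real.log_lt_iff_lt_exp hb).2 h
  linarith

lemma LogUniformlySlowlyVarying.mono {ℓ : ℝ → ℝ} {D D' : ℝ} (h : LogUniformlySlowlyVarying ℓ D)
    (hD : D' ≤ D) : LogUniformlySlowlyVarying ℓ D' := by
  intro ε hε
  obtain ⟨β, hβ, H⟩ := h ε hε
  refine ⟨min β (Real.exp (-1)), lt_min hβ (Real.exp_pos _), fun b hb hbβ => ?_⟩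
  have hL := neg_log_gt_of_lt_exp hb (hbβ.trans_le (min_le_right _ _))
  obtain ⟨h1, h2⟩ := H b hb (hbβ.trans_le (min_le_left _ _))
  exact ⟨h1, fun y hy hyD => h2 y hy (hyD.trans (Real.rpow_le_rpow_of_exponent_le hL.le hD))⟩

/-- Division by `y` is done in two stages, by `y₁ = min y ((-log b)^D)` and then by `y / y₁`. The
second stage starts from `b / y₁ ≤ b`, where `-log` is larger, so its range still suffices. -/
lemma LogUniformlySlowlyVarying.add {ℓ : ℝ → ℝ} {D Δ : ℝ} (h : LogUniformlySlowlyVarying ℓ D)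
    (h' : LogUniformlySlowlyVarying ℓ Δ) (hD : 0 ≤ D) (hΔ : 0 ≤ Δ) :
    LogUniformlySlowlyVarying ℓ (D + Δ) := by
  intro ε hε
  have hε' : 0 < min (ε / 3) 1 := lt_min (by linarith) one_pos
  obtain ⟨β, hβ, H⟩ := h _ hε'
  obtain ⟨β', hβ', H'⟩ := h' _ hε'
  refine ⟨min (min β β') (Real.exp (-1)), lt_min (lt_min hβ hβ') (Real.exp_pos _),
    fun b hb hbβ => ?_⟩
  have hL := neg_log_gt_of_lt_exp hb (hbβ.trans_le (min_le_right _ _))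
  have hb1 : b < β := hbβ.trans_le ((min_le_left _ _).trans (min_le_left _ _))
  have hb2 : b < β' := hbβ.trans_le ((min_le_left _ _).trans (min_le_right _ _))
  obtain ⟨h1, h2⟩ := H b hb hb1
  refine ⟨h1, fun y hy hyD => ?_⟩
  have hLD : 1 ≤ (-Real.log b) ^ D := Real.one_le_rpow hL.le hD
  set y₁ := min y ((-Real.log b) ^ D)
  have hy₁ : 1 ≤ y₁ := le_min hy hLD
  have hy₁0 : 0 < y₁ := by linarith
  have hbb : b / y₁ ≤ b := div_le_self hb.le hy₁
  have hb' : 0 < b / y₁ := div_pos hb hy₁0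
  obtain ⟨h3, h4⟩ := H' (b / y₁) hb' (hbb.trans_lt hb2)
  have e1 := h2 y₁ hy₁ (min_le_right _ _)
  have hlog : -Real.log b ≤ -Real.log (b / y₁) := neg_le_neg (Real.log_le_log hb' hbb)
  have hy₂ : y / y₁ ≤ (-Real.log b) ^ Δ := by
    rw [div_le_iff₀ hy₁0]
    rcases min_choice y ((-Real.log b) ^ D) with hm | hm
    · rw [show y₁ = y from hm]
      exact le_mul_of_one_le_left (by linarith) (Real.one_le_rpow hL.le hΔ)
    · rw [show y₁ = (-Real.log b) ^ D from hm, ← Real.rpow_add (by linarith), add_comm]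
      exact hyD
  have e2 := h4 (y / y₁) ((one_le_div hy₁0).2 (min_le_left _ _))
    (hy₂.trans (Real.rpow_le_rpow (by linarith) hlog hΔ))
  rw [div_div_div_cancel_right₀ hy₁0.ne'] at e2
  set r₁ := ℓ (b / y₁) / ℓ b
  set r₂ := ℓ (b / y) / ℓ (b / y₁)
  have hr : ℓ (b / y) / ℓ b = r₂ * r₁ := by
    simp only [r₁, r₂]
    field_simp
  have hm1 : min (ε / 3) 1 ≤ ε / 3 := min_le_left _ _
  have hm2 : min (ε / 3) 1 ≤ 1 := min_le_right _ _
  rw [hr, show r₂ * r₁ - 1 = (r₂ - 1) * (r₁ - 1) + (r₂ - 1) + (r₁ - 1) by ring]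
  calc _ ≤ |(r₂ - 1) * (r₁ - 1)| + |r₂ - 1| + |r₁ - 1| :=
        (abs_add_le _ _).trans (by gcongr; exact abs_add_le _ _)
    _ ≤ min (ε / 3) 1 * 1 + min (ε / 3) 1 + min (ε / 3) 1 := by
        rw [abs_mul]
        gcongr
        exact e1.trans hm2
    _ ≤ ε := by linarith

/-- Super-slow variation with auxiliary function `1 / (-log t)` allows any power of `-log t`. -/
lemma IsSuperSlowlyVarying.logUniformlySlowlyVarying {ℓ : ℝ → ℝ}
    (h : IsSuperSlowlyVarying ℓ (fun t => (-Real.log t)⁻¹)) (hℓ : ∀ x, 0 < x → 0 ≤ ℓ x) (D : ℝ) :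
    LogUniformlySlowlyVarying ℓ D := by
  obtain ⟨-, Δ, hΔ, hu⟩ := h
  have base : LogUniformlySlowlyVarying ℓ Δ := by
    intro ε hε
    obtain ⟨β, hβ, H⟩ := exists_forall_of_eventually_nhdsGT_zero
      (Metric.tendstoUniformlyOn_iff.1 hu (min ε 1) (lt_min hε one_pos))
    refine ⟨min β (Real.exp (-1)), lt_min hβ (Real.exp_pos _), fun b hb hbβ => ?_⟩
    have hL := neg_log_gt_of_lt_exp hb (hbβ.trans_le (min_le_right _ _))
    have hH := H b hb (hbβ.trans_le (min_le_left _ _))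
    -- At `δ = 0` the quotient would be `0 / 0 = 0`, at distance `1` from the limit.
    have hne : ℓ b ≠ 0 := by
      intro h0
      have := hH 0 ⟨le_rfl, hΔ.le⟩
      rw [h0, div_zero, Real.dist_eq] at this
      have h1 : min ε 1 ≤ 1 := min_le_right _ _
      norm_num at this
    refine ⟨lt_of_le_of_ne (hℓ b hb) hne.symm, fun y hy hyD => ?_⟩
    have hy0 : 0 < y := by linarith
    have hlogL : 0 < Real.log (-Real.log b) := Real.log_pos hL
    -- This exponent is chosen so that `ξ(b)^δ = 1 / y`.
    have hδ : Real.log y / Real.log (-Real.log b) ∈ Icc 0 Δ := by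
      refine ⟨div_nonneg (Real.log_nonneg hy) hlogL.le, ?_⟩
      rw [div_le_iff₀ hlogL, ← Real.log_rpow (by linarith)]
      exact Real.log_le_log hy0 hyD
    have hpow : (-Real.log b)⁻¹ ^ (Real.log y / Real.log (-Real.log b)) = y⁻¹ := by
      rw [Real.inv_rpow (by linarith), Real.rpow_def_of_pos (by linarith),
        mul_div_cancel₀ _ hlogL.ne', Real.exp_log hy0]
    have := hH _ hδ
    rw [hpow, ← div_eq_mul_inv, dist_comm, Real.dist_eq] at this
    exact this.le.trans (min_le_left _ _)
  have hmul : ∀ n : ℕ, LogUniformlySlowlyVarying ℓ ((n + 1 : ℕ) * Δ) := by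
    intro n
    induction n with
    | zero => simpa using base
    | succ n ih =>
      have := ih.add base (by positivity) hΔ.le
      convert this using 1
      push_cast
      ring
  obtain ⟨n, hn⟩ := exists_nat_ge (D / Δ)
  refine (hmul n).mono ?_
  rw [div_le_iff₀ hΔ] at hn
  refine hn.trans (mul_le_mul_of_nonneg_right ?_ hΔ.le)
  push_cast
  linarith

/-! ### Tail asymptotics along the generalised inverse -/

/-- A tail function `G x = x ^ (-α) * ℓ x` that is nonincreasing, tends to `0` at infinity and
whose slowly varying part is insensitive to logarithmic factors at `0`, with a generalised inverse
`a` of `1 / G`. -/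
structure IsTailWithInverse (G ℓ a : ℝ → ℝ) (α : ℝ) : Prop where
  pos : 0 < α
  le_two : α ≤ 2
  nonneg : ∀ x, 0 < x → 0 ≤ G x
  anti : AntitoneOn G (Ioi 0)
  tendsto_zero : Tendsto G atTop (𝓝 0)
  eq_rpow_mul : ∀ x, 0 < x → G x = x ^ (-α) * ℓ x
  slow : ∀ D, LogUniformlySlowlyVarying ℓ D
  inv_pos : ∀ s, 0 < s → 0 < a s
  inv_mono : MonotoneOn a (Ioi 0)
  le_of_lt_inv : ∀ s x, 0 < s → 0 < x → x < a s → 1 / s ≤ G x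
  le_of_inv_lt : ∀ s x, 0 < s → a s < x → G x ≤ 1 / s

namespace IsTailWithInverse

variable {G ℓ a : ℝ → ℝ} {α : ℝ}

lemma div_eq (h : IsTailWithInverse G ℓ a α) {b y : ℝ} (hb : 0 < b) (hy : 0 < y) :
    ℓ (b / y) / ℓ b = G (b / y) * y ^ (-α) / G b := by
  rw [h.eq_rpow_mul b hb, h.eq_rpow_mul _ (div_pos hb hy), Real.div_rpow hb.le hy.le]
  have h1 := (Real.rpow_pos_of_pos hb (-α)).ne'
  have h2 := (Real.rpow_pos_of_pos hy (-α)).ne'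
  field_simp

/-- Halving a small argument multiplies `G` by at most `2 · 2^α ≤ 8 = 2^3`, and iteration gives the
power `3`. This crude bound serves to make `a(s)` at most of order `s^(1/3)`. -/
lemma exists_le_pow (h : IsTailWithInverse G ℓ a α) :
    ∃ K > 0, ∃ β > 0, ∀ x, 0 < x → x ≤ β → G x * x ^ 3 ≤ K := by
  obtain ⟨β₀, hβ₀, H⟩ := h.slow 1 1 one_pos
  set β := min (β₀ / 2) (Real.exp (-2) / 2) with hβdef
  have hβ : 0 < β := lt_min (by linarith) (by positivity)
  have hβ1 : β < β₀ := (min_le_left _ _).trans_lt (by linarith)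
  have hβ2 : β < Real.exp (-2) := (min_le_right _ _).trans_lt (by linarith [Real.exp_pos (-2)])
  have hhalf : ∀ b, 0 < b → b ≤ β → G (b / 2) ≤ 8 * G b := by
    intro b hb hbβ
    obtain ⟨h1, h2⟩ := H b hb (hbβ.trans_lt hβ1)
    have hL := neg_log_gt_of_lt_exp hb (hbβ.trans_lt hβ2)
    have h3 := h2 2 one_le_two (by rw [Real.rpow_one]; exact hL.le)
    rw [h.div_eq hb two_pos] at h3
    have hG : 0 < G b := by
      rw [h.eq_rpow_mul b hb]
      exact mul_pos (Real.rpow_pos_of_pos hb _) h1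
    have h4 : G (b / 2) * 2 ^ (-α) ≤ 2 * G b := by
      rw [← div_le_iff₀ hG]
      linarith [(abs_le.1 h3).2]
    have h5 : (1 : ℝ) / 4 ≤ 2 ^ (-α) := by
      calc (1 : ℝ) / 4 = 2 ^ (-2 : ℝ) := by
            rw [Real.rpow_neg two_pos.le]; norm_num
        _ ≤ 2 ^ (-α) := Real.rpow_le_rpow_of_exponent_le one_le_two (neg_le_neg h.le_two)
    nlinarith [h.nonneg (b / 2) (by linarith)]
  have hiter : ∀ n : ℕ, G (β / 2 ^ n) ≤ 8 ^ n * G β := by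
    intro n
    induction n with
    | zero => simp
    | succ n ih =>
      have hb : β / 2 ^ n ≤ β := div_le_self hβ.le (one_le_pow₀ one_le_two)
      have := hhalf (β / 2 ^ n) (by positivity) hb
      rw [pow_succ, ← div_div]
      calc _ ≤ _ := this
        _ ≤ 8 * (8 ^ n * G β) := by gcongr
        _ = _ := by ring
  refine ⟨8 * G β * β ^ 3 + 1, by have := h.nonneg β hβ; positivity, β, hβ, fun x hx hxβ => ?_⟩
  obtain ⟨n, hn1, hn2⟩ := exists_nat_pow_near ((one_le_div hx).2 hxβ) (one_lt_two)
  have hx1 : x ≤ β / 2 ^ n := by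
    rw [le_div_iff₀ hx] at hn1
    rw [le_div_iff₀ (by positivity)]
    linarith
  have hx2 : β / 2 ^ (n + 1) ≤ x := by
    rw [div_lt_iff₀ hx] at hn2
    rw [div_le_iff₀ (by positivity)]
    linarith
  have hGx : G x ≤ 8 ^ (n + 1) * G β :=
    (h.anti (mem_Ioi.2 (by positivity)) (mem_Ioi.2 hx) hx2).trans (hiter (n + 1))
  have hx3 : x ^ 3 ≤ β ^ 3 / 8 ^ n := by
    calc x ^ 3 ≤ (β / 2 ^ n) ^ 3 := by gcongr
      _ = β ^ 3 / 8 ^ n := by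
        rw [div_pow, ← pow_mul, mul_comm n 3, pow_mul]; norm_num
  calc G x * x ^ 3 ≤ (8 ^ (n + 1) * G β) * (β ^ 3 / 8 ^ n) := by
        have := h.nonneg β hβ
        gcongr
    _ = 8 * G β * β ^ 3 := by rw [pow_succ]; field_simp
    _ ≤ _ := by linarith

lemma eventually_inv_lt (h : IsTailWithInverse G ℓ a α) {β : ℝ} (hβ : 0 < β) :
    ∀ᶠ s in 𝓝[>] (0 : ℝ), a s < β := by
  have h1 : Tendsto (fun s : ℝ => 1 / s) (𝓝[>] 0) atTop := by
    simpa only [one_div] using tendsto_inv_nhdsGT_zero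
  filter_upwards [h1.eventually_gt_atTop (G (β / 2)), self_mem_nhdsWithin] with s hs hs0
  by_contra hcon
  exact (h.le_of_lt_inv s (β / 2) hs0 (by linarith) (by linarith [not_lt.1 hcon])).not_gt hs

lemma exists_inv_pow_le (h : IsTailWithInverse G ℓ a α) :
    ∃ K > 0, ∀ᶠ s in 𝓝[>] (0 : ℝ), a s ^ 3 ≤ K * s := by
  obtain ⟨K, hK, β, hβ, H⟩ := h.exists_le_pow
  refine ⟨8 * K, by positivity, ?_⟩
  filter_upwards [h.eventually_inv_lt hβ, self_mem_nhdsWithin] with s hs hs0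
  have ha := h.inv_pos s hs0
  have hs0' : 0 < s := hs0
  have h1 := H (a s / 2) (by linarith) (by linarith)
  have h2 := h.le_of_lt_inv s (a s / 2) hs0 (by linarith) (by linarith)
  have h3 : 1 / s * (a s / 2) ^ 3 ≤ K := (mul_le_mul_of_nonneg_right h2 (by positivity)).trans h1
  rw [one_div, inv_mul_le_iff₀ hs0'] at h3
  nlinarith

lemma tendsto_neg_log_nhdsGT_zero : Tendsto (fun s => -Real.log s) (𝓝[>] (0 : ℝ)) atTop :=
  tendsto_neg_atBot_atTop.comp Real.tendsto_log_nhdsGT_zero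

/-- A logarithmic factor `y` cannot offset the polynomial decay of `a`: `(y a(s))^6 ≤ s` eventually.
So `-log (y a(s)) ≥ -log s / 6`, and the extra unit in the exponent `2 / α + 1` absorbs the
constants. -/
lemma eventually_mul_inv_lt (h : IsTailWithInverse G ℓ a α) {β : ℝ} (hβ : 0 < β) :
    ∀ᶠ s in 𝓝[>] (0 : ℝ), ∀ y, 2 ≤ y → y ≤ (-Real.log s) ^ (2 / α) →
      y * a s < β ∧ 2 * y ≤ (-Real.log (y * a s)) ^ (2 / α + 1) := by
  obtain ⟨K, hK, hKs⟩ := h.exists_inv_pow_le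
  have hα := h.pos
  have hdecay : Tendsto (fun s => (-Real.log s) ^ (12 / α) * Real.exp (-1 * -Real.log s))
      (𝓝[>] (0 : ℝ)) (𝓝 0) :=
    (tendsto_rpow_mul_exp_neg_mul_atTop_nhds_zero (12 / α) 1 one_pos).comp
      tendsto_neg_log_nhdsGT_zero
  have hK2 : 0 < 1 / K ^ 2 := by positivity
  have hsmall : ∀ᶠ s in 𝓝[>] (0 : ℝ), s < β ^ 6 :=
    nhdsWithin_le_nhds (gt_mem_nhds (by positivity))
  filter_upwards [hKs, self_mem_nhdsWithin, hdecay.eventually (gt_mem_nhds hK2), hsmall,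
    tendsto_neg_log_nhdsGT_zero.eventually_ge_atTop (2 * 6 ^ (2 / α + 1)),
    tendsto_neg_log_nhdsGT_zero.eventually_gt_atTop 0] with s h1 hs0 h2 h3 h4 h5 y hy hyL
  have hs0 : 0 < s := hs0
  have ha := h.inv_pos s hs0
  have hy0 : 0 < y := by linarith
  rw [neg_one_mul, neg_neg, Real.exp_log hs0, lt_div_iff₀ (by positivity)] at h2
  have h6 : (y * a s) ^ 6 ≤ s := by
    have hy6 : y ^ 6 ≤ (-Real.log s) ^ (12 / α) := by
      calc y ^ 6 ≤ ((-Real.log s) ^ (2 / α)) ^ 6 := by gcongr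
        _ = (-Real.log s) ^ (12 / α) := by
          rw [← Real.rpow_natCast, ← Real.rpow_mul h5.le]
          congr 1
          push_cast
          ring
    calc (y * a s) ^ 6 = y ^ 6 * (a s ^ 3) ^ 2 := by ring
      _ ≤ (-Real.log s) ^ (12 / α) * (K * s) ^ 2 := by gcongr
      _ = ((-Real.log s) ^ (12 / α) * s * K ^ 2) * s := by ring
      _ ≤ 1 * s := by gcongr
      _ = s := one_mul s
  have hya : 0 < y * a s := mul_pos hy0 ha
  refine ⟨lt_of_pow_lt_pow_left₀ 6 hβ.le (h6.trans_lt h3), ?_⟩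
  have h7 : -Real.log s / 6 ≤ -Real.log (y * a s) := by
    have := Real.log_le_log (by positivity) h6
    rw [Real.log_pow] at this
    push_cast at this
    linarith
  calc 2 * y ≤ 2 * (-Real.log s) ^ (2 / α) := by gcongr
    _ ≤ (-Real.log s / 6) ^ (2 / α + 1) := by
      rw [Real.div_rpow h5.le (by norm_num), le_div_iff₀ (by positivity),
        Real.rpow_add_one h5.ne']
      have : 0 < (-Real.log s) ^ (2 / α) := Real.rpow_pos_of_pos h5 _
      nlinarith
    _ ≤ _ := Real.rpow_le_rpow (by positivity) h7 (by positivity)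

/-- `G (y * a s)` is close to `y ^ (-α) / s`, uniformly in `2 ≤ y ≤ (-log s) ^ (2 / α)`. -/
lemma exists_bounds (h : IsTailWithInverse G ℓ a α) {η : ℝ} (hη : 0 < η) :
    ∀ᶠ s in 𝓝[>] (0 : ℝ), ∀ y, 2 ≤ y → y ≤ (-Real.log s) ^ (2 / α) →
      (1 - η) * y ^ (-α) / s ≤ G (y * a s) ∧ G (y * a s) ≤ (1 + η) * y ^ (-α) / s := by
  have hα := h.pos
  -- `G` is compared with `1 / s` only strictly below and strictly above `a(s)`, so the points `lam
  -- * a s` and `a s / lam` are used, with `lam` close to `1`. They are reached from `y * a s` on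
  -- dividing by `y / lam` and `y * lam`.
  obtain ⟨lam, hlam, hlam2, hlo, hhi⟩ : ∃ lam : ℝ, 1 / 2 < lam ∧ lam < 1 ∧
      1 - η ≤ lam ^ α / (2 - lam) ∧ lam ^ (-α) / lam ≤ 1 + η := by
    have c1 : ContinuousAt (fun r : ℝ => r ^ α / (2 - r)) 1 :=
      (Real.continuousAt_rpow_const 1 α (Or.inl one_ne_zero)).div
        (continuousAt_const.sub continuousAt_id) (by norm_num)
    have c2 : ContinuousAt (fun r : ℝ => r ^ (-α) / r) 1 :=
      (Real.continuousAt_rpow_const 1 (-α) (Or.inl one_ne_zero)).div continuousAt_id (by norm_num)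
    have t1 := c1.tendsto.mono_left (nhdsWithin_le_nhds (s := Iio (1 : ℝ)))
    have t2 := c2.tendsto.mono_left (nhdsWithin_le_nhds (s := Iio (1 : ℝ)))
    have hev : ∀ᶠ r : ℝ in 𝓝[<] 1, 1 / 2 < r :=
      nhdsWithin_le_nhds (lt_mem_nhds (by norm_num))
    have e1 : 1 - η < (1 : ℝ) ^ α / (2 - 1) := by norm_num; exact hη
    have e2 : (1 : ℝ) ^ (-α) / 1 < 1 + η := by norm_num; exact hη
    obtain ⟨r, h1, h2, h3, h4⟩ := (hev.and (eventually_mem_nhdsWithin.and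
      ((t1.eventually (lt_mem_nhds e1)).and (t2.eventually (gt_mem_nhds e2))))).exists
    exact ⟨r, h1, h2, h3.le, h4.le⟩
  have hlam0 : 0 < lam := by linarith
  obtain ⟨β, hβ, H⟩ := h.slow (2 / α + 1) (1 - lam) (by linarith)
  filter_upwards [h.eventually_mul_inv_lt hβ, self_mem_nhdsWithin] with s hs hs0 y hy hyL
  have hs0 : 0 < s := hs0
  obtain ⟨hb, hyb⟩ := hs y hy hyL
  have ha := h.inv_pos s hs0
  have hy0 : 0 < y := by linarith
  have hya : 0 < y * a s := mul_pos hy0 ha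
  obtain ⟨hℓ, hslow⟩ := H _ hya hb
  have hG : 0 < G (y * a s) := by
    rw [h.eq_rpow_mul _ hya]
    exact mul_pos (Real.rpow_pos_of_pos hya _) hℓ
  have hyp : 0 < y ^ (-α) := Real.rpow_pos_of_pos hy0 _
  have hlp : 0 < lam ^ α := Real.rpow_pos_of_pos hlam0 _
  constructor
  · have h1 := hslow (y / lam) ((one_le_div hlam0).2 (by linarith))
      (le_trans (by rw [div_le_iff₀ hlam0]; nlinarith) hyb)
    rw [h.div_eq hya (by positivity)] at h1
    have h2 := (abs_le.1 h1).2
    rw [show y * a s / (y / lam) = lam * a s by field_simp] at h2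
    have h3 := h.le_of_lt_inv s (lam * a s) hs0 (by positivity) (by nlinarith)
    have h4 : G (lam * a s) * (y / lam) ^ (-α) ≤ (2 - lam) * G (y * a s) := by
      rw [← div_le_iff₀ hG]; linarith
    have h5 : (y / lam) ^ (-α) = y ^ (-α) * lam ^ α := by
      rw [Real.div_rpow hy0.le hlam0.le, Real.rpow_neg hlam0.le, div_inv_eq_mul]
    rw [h5] at h4
    have h6 : 1 / s * (y ^ (-α) * lam ^ α) ≤ (2 - lam) * G (y * a s) :=
      (mul_le_mul_of_nonneg_right h3 (by positivity)).trans h4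
    calc (1 - η) * y ^ (-α) / s ≤ lam ^ α / (2 - lam) * y ^ (-α) / s := by gcongr
      _ = 1 / s * (y ^ (-α) * lam ^ α) / (2 - lam) := by ring
      _ ≤ G (y * a s) := by
        rw [div_le_iff₀ (by linarith)]; linarith
  · have h1 := hslow (y * lam) (by nlinarith) (le_trans (by nlinarith) hyb)
    rw [h.div_eq hya (by positivity)] at h1
    have h2 := (abs_le.1 h1).1
    rw [show y * a s / (y * lam) = a s / lam by field_simp] at h2
    have h3 := h.le_of_inv_lt s (a s / lam) hs0 (by rw [lt_div_iff₀ hlam0]; nlinarith)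
    have h4 : lam * G (y * a s) ≤ G (a s / lam) * (y * lam) ^ (-α) := by
      rw [← le_div_iff₀ hG]; linarith
    rw [Real.mul_rpow hy0.le hlam0.le] at h4
    have hlp' : 0 < lam ^ (-α) := Real.rpow_pos_of_pos hlam0 _
    have h6 : lam * G (y * a s) ≤ 1 / s * (y ^ (-α) * lam ^ (-α)) :=
      h4.trans (mul_le_mul_of_nonneg_right h3 (by positivity))
    calc G (y * a s) ≤ 1 / s * (y ^ (-α) * lam ^ (-α)) / lam := by
          rw [le_div_iff₀ hlam0]; linarith
      _ = lam ^ (-α) / lam * y ^ (-α) / s := by ring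
      _ ≤ (1 + η) * y ^ (-α) / s := by gcongr

end IsTailWithInverse

/-! ### The limit of the integral -/

lemma integral_inv_mul_log_sq {s₁ s₀ : ℝ} (h0 : 0 < s₁) (h1 : s₁ ≤ s₀) (h2 : s₀ < 1) :
    IntervalIntegrable (fun s => 1 / (s * Real.log s ^ 2)) volume s₁ s₀ ∧
      ∫ s in s₁..s₀, 1 / (s * Real.log s ^ 2) = (Real.log s₁)⁻¹ - (Real.log s₀)⁻¹ := by
  have hne : ∀ s ∈ uIcc s₁ s₀, s ≠ 0 ∧ Real.log s ≠ 0 := by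
    intro s hs
    rw [uIcc_of_le h1] at hs
    have hs0 : 0 < s := h0.trans_le hs.1
    exact ⟨hs0.ne', (Real.log_neg hs0 (hs.2.trans_lt h2)).ne⟩
  have hint : IntervalIntegrable (fun s => 1 / (s * Real.log s ^ 2)) volume s₁ s₀ := by
    refine ContinuousOn.intervalIntegrable ?_
    refine continuousOn_const.div (continuousOn_id.mul ((Real.continuousOn_log.mono ?_).pow 2)) ?_
    · exact fun s hs => (hne s hs).1
    · exact fun s hs => mul_ne_zero (hne s hs).1 (pow_ne_zero 2 (hne s hs).2)
  refine ⟨hint, ?_⟩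
  rw [intervalIntegral.integral_eq_sub_of_hasDerivAt (f := fun s => -(Real.log s)⁻¹) ?_ hint]
  · ring
  · intro s hs
    refine ((Real.hasDerivAt_log (hne s hs).1).inv (hne s hs).2).neg.congr_deriv ?_
    have h3 := (hne s hs).1
    have h4 := (hne s hs).2
    field_simp

namespace IsTailWithInverse

variable {G ℓ a : ℝ → ℝ} {α : ℝ}

lemma antitone_barrier (h : IsTailWithInverse G ℓ a α) {y t : ℝ} (hy : 0 < y) (ht : 0 < t) :
    Antitone fun u => G (y * a (max u t)) := by
  intro u v huv
  have hu : 0 < max u t := ht.trans_le (le_max_right _ _)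
  have hv : 0 < max v t := ht.trans_le (le_max_right _ _)
  exact h.anti (mem_Ioi.2 (mul_pos hy (h.inv_pos _ hu))) (mem_Ioi.2 (mul_pos hy (h.inv_pos _ hv)))
    (mul_le_mul_of_nonneg_left (h.inv_mono hu hv (max_le_max_right t huv)) hy.le)

/-- Bounds for the integral of `G (y * a s)` in terms of `y` and of a threshold `s₀`. -/
lemma integral_bounds (h : IsTailWithInverse G ℓ a α) {η s₀ : ℝ} (hη : 0 < η) (hη1 : η < 1)
    (hs₀ : 0 < s₀)
    (hs₀1 : s₀ < 1) (hs₀2 : 2 ≤ (-Real.log s₀) ^ (2 / α))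
    (H : ∀ s, 0 < s → s ≤ s₀ → ∀ y, 2 ≤ y → y ≤ (-Real.log s) ^ (2 / α) →
      (1 - η) * y ^ (-α) / s ≤ G (y * a s) ∧ G (y * a s) ≤ (1 + η) * y ^ (-α) / s)
    {t y : ℝ} (ht : 0 < t) (hy : 2 ≤ y) (hts : t ≤ Real.exp (-y ^ (α / 2)))
    (hss : Real.exp (-y ^ (α / 2)) ≤ s₀) :
    (1 - η) * y ^ (-α) * (-Real.log t - y ^ (α / 2)) ≤
        ∫ u in (0 : ℝ)..1, G (y * a (max u t)) ∧
      ∫ u in (0 : ℝ)..1, G (y * a (max u t)) ≤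
        (1 + η) * y ^ (-α) * (1 + (-Real.log t - y ^ (α / 2))) +
          (1 + η) * (-Real.log s₀)⁻¹ + G (y * a s₀) := by
  have hα := h.pos
  have hy0 : 0 < y := by linarith
  -- At this point `(-log s₁)^(2/α) = y`: the uniform estimate applies to `y` itself exactly up to
  -- `s₁`.
  set s₁ := Real.exp (-y ^ (α / 2)) with hs₁def
  have hs₁ : 0 < s₁ := Real.exp_pos _
  have hlogs₁ : Real.log s₁ = -y ^ (α / 2) := Real.log_exp _
  have hyp : 0 < y ^ (-α) := Real.rpow_pos_of_pos hy0 _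
  have hypow : (y ^ (α / 2)) ^ (2 / α) = y := by
    rw [← Real.rpow_mul hy0.le, show α / 2 * (2 / α) = 1 by field_simp, Real.rpow_one]
  set F : ℝ → ℝ := fun u => G (y * a (max u t)) with hF
  have hanti : Antitone F := h.antitone_barrier hy0 ht
  have hint : ∀ p q : ℝ, IntervalIntegrable F volume p q := fun p q => hanti.intervalIntegrable
  have hF0 : ∀ u, 0 ≤ F u := fun u => by
    have hu : 0 < max u t := ht.trans_le (le_max_right _ _)
    exact h.nonneg _ (mul_pos hy0 (h.inv_pos _ hu))
  have hFt : ∀ u, t ≤ u → F u = G (y * a u) := fun u hu => by simp only [hF, max_eq_left hu]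
  -- the range `s ≤ s₁`, where `y` is at most the logarithmic bound
  have hA : ∀ s, t ≤ s → s ≤ s₁ →
      (1 - η) * y ^ (-α) * s⁻¹ ≤ F s ∧ F s ≤ (1 + η) * y ^ (-α) * s⁻¹ := by
    intro s hs hs1
    have hs0 : 0 < s := ht.trans_le hs
    have hlog : y ^ (α / 2) ≤ -Real.log s := by
      have := Real.log_le_log hs0 hs1
      rw [hlogs₁] at this
      linarith
    rw [hFt s hs, ← div_eq_mul_inv, ← div_eq_mul_inv]
    refine H s hs0 (hs1.trans hss) y hy ?_
    calc y = (y ^ (α / 2)) ^ (2 / α) := hypow.symm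
      _ ≤ _ := Real.rpow_le_rpow (by positivity) hlog (by positivity)
  -- Here `y` is too large for the uniform estimate, so it is lowered to the largest admissible
  -- value `Y`, for which `Y^(-α) = 1 / log² s`.
  have hB : ∀ s, s₁ ≤ s → s ≤ s₀ → F s ≤ (1 + η) * (1 / (s * Real.log s ^ 2)) := by
    intro s hs hs1
    have hs0 : 0 < s := hs₁.trans_le hs
    have hlog : -Real.log s ≤ y ^ (α / 2) := by
      have := Real.log_le_log hs₁ hs
      rw [hlogs₁] at this
      linarith
    have hlogs : -Real.log s₀ ≤ -Real.log s := neg_le_neg (Real.log_le_log hs0 hs1)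
    have hlog0 : 0 < -Real.log s₀ := neg_pos.2 (Real.log_neg hs₀ hs₀1)
    have hlogp : 0 < -Real.log s := hlog0.trans_le hlogs
    set Y := (-Real.log s) ^ (2 / α) with hY
    have hY2 : 2 ≤ Y := hs₀2.trans (Real.rpow_le_rpow hlog0.le hlogs (by positivity))
    have hYy : Y ≤ y := by
      calc Y ≤ (y ^ (α / 2)) ^ (2 / α) := Real.rpow_le_rpow hlogp.le hlog (by positivity)
        _ = y := hypow
    have hYα : Y ^ (-α) = ((Real.log s) ^ 2)⁻¹ := by
      rw [hY, ← Real.rpow_mul hlogp.le, mul_neg, div_mul_cancel₀ _ hα.ne',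
        Real.rpow_neg hlogp.le, Real.rpow_two, neg_sq]
    have ha := h.inv_pos s hs0
    rw [hFt s (hts.trans hs)]
    calc G (y * a s) ≤ G (Y * a s) :=
          h.anti (mem_Ioi.2 (by positivity)) (mem_Ioi.2 (by positivity)) (by gcongr)
      _ ≤ (1 + η) * Y ^ (-α) / s := (H s hs0 hs1 Y hY2 le_rfl).2
      _ = _ := by rw [hYα]; field_simp
  have hC : ∀ s, s₀ ≤ s → F s ≤ G (y * a s₀) := by
    intro s hs
    rw [← hFt s₀ (hts.trans hss)]
    exact hanti hs
  have h01 : ∫ u in (0 : ℝ)..t, F u = t * G (y * a t) := by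
    rw [intervalIntegral.integral_congr (g := fun _ => G (y * a t)), intervalIntegral.integral_const,
      sub_zero, smul_eq_mul]
    intro u hu
    rw [uIcc_of_le ht.le] at hu
    simp only [hF, max_eq_right hu.2]
  have hinv : IntervalIntegrable (fun s : ℝ => s⁻¹) volume t s₁ := by
    refine intervalIntegral.intervalIntegrable_inv (fun s hs => ?_) continuousOn_id
    rw [uIcc_of_le hts] at hs
    exact (ht.trans_le hs.1).ne'
  have hinvval : ∫ s in t..s₁, s⁻¹ = -Real.log t - y ^ (α / 2) := by
    rw [integral_inv_of_pos ht hs₁, Real.log_div hs₁.ne' ht.ne', hlogs₁]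
    ring
  have hsplit : ∫ u in (0 : ℝ)..1, F u = (∫ u in (0 : ℝ)..t, F u) + (∫ u in t..s₁, F u) +
      (∫ u in s₁..s₀, F u) + ∫ u in s₀..1, F u := by
    rw [intervalIntegral.integral_add_adjacent_intervals (hint _ _) (hint _ _),
      intervalIntegral.integral_add_adjacent_intervals (hint _ _) (hint _ _),
      intervalIntegral.integral_add_adjacent_intervals (hint _ _) (hint _ _)]
  have lowA : (1 - η) * y ^ (-α) * (-Real.log t - y ^ (α / 2)) ≤ ∫ u in t..s₁, F u := by
    rw [← hinvval, ← intervalIntegral.integral_const_mul]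
    exact intervalIntegral.integral_mono_on hts (hinv.const_mul _) (hint _ _)
      fun s hs => (hA s hs.1 hs.2).1
  have upA : ∫ u in t..s₁, F u ≤ (1 + η) * y ^ (-α) * (-Real.log t - y ^ (α / 2)) := by
    rw [← hinvval, ← intervalIntegral.integral_const_mul]
    exact intervalIntegral.integral_mono_on hts (hint _ _) (hinv.const_mul _)
      fun s hs => (hA s hs.1 hs.2).2
  -- The barrier is constant on `[0, t]`; this piece accounts for the summand `1` in the upper
  -- bound.
  have upT : t * G (y * a t) ≤ (1 + η) * y ^ (-α) := by
    have := (hA t le_rfl hts).2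
    rw [hFt t le_rfl, ← div_eq_mul_inv, le_div_iff₀ ht] at this
    linarith
  have upB : ∫ u in s₁..s₀, F u ≤ (1 + η) * (-Real.log s₀)⁻¹ := by
    obtain ⟨hi, hv⟩ := integral_inv_mul_log_sq hs₁ hss hs₀1
    calc _ ≤ ∫ s in s₁..s₀, (1 + η) * (1 / (s * Real.log s ^ 2)) :=
          intervalIntegral.integral_mono_on hss (hint _ _) (hi.const_mul _)
            fun s hs => hB s hs.1 hs.2
      _ = (1 + η) * ((Real.log s₁)⁻¹ - (Real.log s₀)⁻¹) := by
          rw [intervalIntegral.integral_const_mul, hv]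
      _ ≤ _ := by
          have : (Real.log s₁)⁻¹ ≤ 0 := by
            rw [hlogs₁]
            exact inv_nonpos.2 (neg_nonpos.2 (by positivity))
          rw [inv_neg]
          gcongr
          linarith
  have upC : ∫ u in s₀..1, F u ≤ G (y * a s₀) := by
    have hG0 : 0 ≤ G (y * a s₀) := h.nonneg _ (mul_pos hy0 (h.inv_pos _ hs₀))
    calc _ ≤ ∫ _ in s₀..1, G (y * a s₀) :=
          intervalIntegral.integral_mono_on hs₀1.le (hint _ _) (by simp) fun s hs => hC s hs.1
      _ = (1 - s₀) * G (y * a s₀) := by rw [intervalIntegral.integral_const, smul_eq_mul]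
      _ ≤ _ := by nlinarith
  have lowT : 0 ≤ ∫ u in (0 : ℝ)..t, F u :=
    intervalIntegral.integral_nonneg ht.le fun u _ => hF0 u
  have lowB : 0 ≤ ∫ u in s₁..s₀, F u :=
    intervalIntegral.integral_nonneg hss fun u _ => hF0 u
  have lowC : 0 ≤ ∫ u in s₀..1, F u :=
    intervalIntegral.integral_nonneg hs₀1.le fun u _ => hF0 u
  rw [hsplit]
  constructor
  · linarith
  · rw [h01]
    linarith

theorem tendsto_integral (h : IsTailWithInverse G ℓ a α) {x : ℝ} (hx : 0 < x) :
    Tendsto (fun t => ∫ u in (0 : ℝ)..1,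
      G (x * (-Real.log t) ^ (1 / α) * a (max u t))) (𝓝[>] 0) (𝓝 (x ^ (-α))) := by
  have hα := h.pos
  have hlog := tendsto_neg_log_nhdsGT_zero
  have hxα : 0 < x ^ (-α) := Real.rpow_pos_of_pos hx _
  have hy : Tendsto (fun t => x * (-Real.log t) ^ (1 / α)) (𝓝[>] (0 : ℝ)) atTop :=
    ((tendsto_rpow_atTop (by positivity)).comp hlog).const_mul_atTop hx
  have hw : Tendsto (fun t => (x * (-Real.log t) ^ (1 / α)) ^ (α / 2)) (𝓝[>] (0 : ℝ)) atTop :=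
    (tendsto_rpow_atTop (by positivity)).comp hy
  have hinv : Tendsto (fun t => (-Real.log t)⁻¹) (𝓝[>] (0 : ℝ)) (𝓝 0) :=
    tendsto_inv_atTop_zero.comp hlog
  have hpow : ∀ L : ℝ, 0 < L → (x * L ^ (1 / α)) ^ (α / 2) = x ^ (α / 2) * L ^ (1 / 2 : ℝ) := by
    intro L hL
    rw [Real.mul_rpow hx.le (by positivity), ← Real.rpow_mul hL.le]
    congr 2
    field_simp
  have hpowα : ∀ L : ℝ, 0 < L → (x * L ^ (1 / α)) ^ (-α) = x ^ (-α) * L⁻¹ := by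
    intro L hL
    rw [Real.mul_rpow hx.le (by positivity), ← Real.rpow_mul hL.le, ← Real.rpow_neg_one]
    congr 2
    field_simp
  have hratio : Tendsto (fun t => (x * (-Real.log t) ^ (1 / α)) ^ (α / 2) * (-Real.log t)⁻¹)
      (𝓝[>] (0 : ℝ)) (𝓝 0) := by
    have h1 : Tendsto (fun t => x ^ (α / 2) * (-Real.log t) ^ (-(1 / 2) : ℝ)) (𝓝[>] (0 : ℝ))
        (𝓝 (x ^ (α / 2) * 0)) :=
      ((tendsto_rpow_neg_atTop (by norm_num)).comp hlog).const_mul _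
    rw [mul_zero] at h1
    refine h1.congr' ?_
    filter_upwards [hlog.eventually_gt_atTop 0] with t ht
    rw [hpow _ ht, mul_assoc, ← Real.rpow_neg_one (-Real.log t), ← Real.rpow_add ht]
    norm_num
  -- choice of the accuracy and of the threshold
  rw [Metric.tendsto_nhds]
  intro e he
  -- The limiting lower error is `η x^(-α)`; the upper one is below `η x^(-α) + 2η`, the second term
  -- coming from `[s₁, s₀]`.
  obtain ⟨η, hη, hη1, hηe⟩ : ∃ η > 0, η < 1 ∧ η * (x ^ (-α) + 2) < e := by
    refine ⟨min (1 / 2) (e / (2 * (x ^ (-α) + 2))), lt_min (by norm_num) (by positivity),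
      (min_le_left _ _).trans_lt (by norm_num), ?_⟩
    calc _ ≤ e / (2 * (x ^ (-α) + 2)) * (x ^ (-α) + 2) := by gcongr; exact min_le_right _ _
      _ = e / 2 := by field_simp
      _ < e := by linarith
  obtain ⟨β, hβ, H⟩ := exists_forall_of_eventually_nhdsGT_zero (h.exists_bounds hη)
  obtain ⟨s₀, hs₀, hs₀β, hs₀1, hs₀2, hs₀η⟩ : ∃ s₀ > 0, s₀ < β ∧ s₀ < 1 ∧
      2 ≤ (-Real.log s₀) ^ (2 / α) ∧ (-Real.log s₀)⁻¹ < η := by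
    have e1 : ∀ᶠ s in 𝓝[>] (0 : ℝ), s < β := nhdsWithin_le_nhds (gt_mem_nhds hβ)
    have e2 : ∀ᶠ s in 𝓝[>] (0 : ℝ), s < 1 := nhdsWithin_le_nhds (gt_mem_nhds one_pos)
    have e3 := ((tendsto_rpow_atTop (y := 2 / α) (by positivity)).comp
      hlog).eventually_ge_atTop 2
    have e4 := hinv.eventually (gt_mem_nhds hη)
    obtain ⟨s, h1, h2, h3, h4, h5⟩ :=
      (eventually_mem_nhdsWithin.and (e1.and (e2.and (e3.and e4)))).exists
    exact ⟨s, h1, h2, h3, h4, h5⟩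
  have hGlim : Tendsto (fun t => G (x * (-Real.log t) ^ (1 / α) * a s₀)) (𝓝[>] (0 : ℝ)) (𝓝 0) :=
    h.tendsto_zero.comp (hy.atTop_mul_const (h.inv_pos _ hs₀))
  have hlow : Tendsto (fun t => (1 - η) * x ^ (-α) *
      (1 - (x * (-Real.log t) ^ (1 / α)) ^ (α / 2) * (-Real.log t)⁻¹)) (𝓝[>] (0 : ℝ))
      (𝓝 ((1 - η) * x ^ (-α))) := by
    simpa using (hratio.const_sub 1).const_mul ((1 - η) * x ^ (-α))
  have hup : Tendsto (fun t => (1 + η) * x ^ (-α) *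
      ((-Real.log t)⁻¹ + (1 - (x * (-Real.log t) ^ (1 / α)) ^ (α / 2) * (-Real.log t)⁻¹)) +
      (1 + η) * (-Real.log s₀)⁻¹ + G (x * (-Real.log t) ^ (1 / α) * a s₀)) (𝓝[>] (0 : ℝ))
      (𝓝 ((1 + η) * x ^ (-α) + (1 + η) * (-Real.log s₀)⁻¹)) := by
    simpa using (((hinv.add (hratio.const_sub 1)).const_mul ((1 + η) * x ^ (-α))).add_const
      ((1 + η) * (-Real.log s₀)⁻¹)).add hGlim
  have hlowe : x ^ (-α) - e < (1 - η) * x ^ (-α) := by nlinarith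
  have hupe : (1 + η) * x ^ (-α) + (1 + η) * (-Real.log s₀)⁻¹ < x ^ (-α) + e := by
    have : (1 + η) * (-Real.log s₀)⁻¹ ≤ 2 * η := by
      have : 0 < (-Real.log s₀)⁻¹ := _root_.inv_pos.2 (neg_pos.2 (Real.log_neg hs₀ hs₀1))
      nlinarith
    nlinarith
  filter_upwards [hlow.eventually (lt_mem_nhds hlowe), hup.eventually (gt_mem_nhds hupe),
    self_mem_nhdsWithin, hlog.eventually_gt_atTop 0, hy.eventually_ge_atTop 2,
    hw.eventually_ge_atTop (-Real.log s₀), hratio.eventually (gt_mem_nhds one_pos)]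
    with t h1 h2 ht0 hL hy2 hw1 hr
  have ht0 : 0 < t := ht0
  have hts : t ≤ Real.exp (-(x * (-Real.log t) ^ (1 / α)) ^ (α / 2)) := by
    rw [← Real.log_le_iff_le_exp ht0]
    rw [← div_eq_mul_inv, div_lt_one hL] at hr
    linarith
  have hss : Real.exp (-(x * (-Real.log t) ^ (1 / α)) ^ (α / 2)) ≤ s₀ := by
    rw [← Real.le_log_iff_exp_le hs₀]
    linarith
  obtain ⟨b1, b2⟩ := h.integral_bounds hη hη1 hs₀ hs₀1 hs₀2
    (fun s hs hs' => H s hs (hs'.trans_lt hs₀β)) ht0 hy2 hts hss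
  rw [hpowα _ hL] at b1 b2
  have hLi : (-Real.log t)⁻¹ * -Real.log t = 1 := inv_mul_cancel₀ hL.ne'
  rw [Real.dist_eq, abs_lt]
  set w := (x * (-Real.log t) ^ (1 / α)) ^ (α / 2)
  set I := ∫ u in (0 : ℝ)..1, G (x * (-Real.log t) ^ (1 / α) * a (max u t))
  have c1 : (1 - η) * (x ^ (-α) * (-Real.log t)⁻¹) * (-Real.log t - w) =
      (1 - η) * x ^ (-α) * (1 - w * (-Real.log t)⁻¹) := by
    linear_combination (1 - η) * x ^ (-α) * hLi
  have c2 : (1 + η) * (x ^ (-α) * (-Real.log t)⁻¹) * (1 + (-Real.log t - w)) =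
      (1 + η) * x ^ (-α) * ((-Real.log t)⁻¹ + (1 - w * (-Real.log t)⁻¹)) := by
    linear_combination (1 + η) * x ^ (-α) * hLi
  rw [c1] at b1
  rw [c2] at b2
  constructor <;> linarith

end IsTailWithInverse

/-! ### The Lévy tail and the conclusion -/

/-- Tails of positive index are unbounded at `0`. -/
lemma exists_doubling_of_logUniformlySlowlyVarying {G ℓ : ℝ → ℝ} {α : ℝ} (hα : 0 < α)
    (hslow : LogUniformlySlowlyVarying ℓ 1) (htail : ∀ x : ℝ, 0 < x → G x = x ^ (-α) * ℓ x) :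
    ∃ b > 0, 0 < G b ∧ ∀ n : ℕ, ∃ z > 0, 2 ^ n * G b ≤ G z := by
  obtain ⟨β, hβ, H⟩ := hslow (1 / 2) (by norm_num)
  -- Dividing by this `y` multiplies the power factor by `4` while `ℓ` loses at most a factor `2`,
  -- so `G` at least doubles.
  set y : ℝ := 4 ^ (1 / α) with hy
  have hy1 : 1 ≤ y := Real.one_le_rpow (by norm_num) (by positivity)
  have hy0 : 0 < y := by linarith
  have hyα : y ^ (-α) = 4⁻¹ := by
    rw [hy, ← Real.rpow_mul (by norm_num), show 1 / α * -α = -1 by field_simp, Real.rpow_neg_one]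
  set b := min β (Real.exp (-y)) / 2 with hbdef
  have hm : 0 < min β (Real.exp (-y)) := lt_min hβ (Real.exp_pos _)
  have hb : 0 < b := half_pos hm
  have hbm : b < min β (Real.exp (-y)) := half_lt_self hm
  have hpos : ∀ z, 0 < z → z ≤ b → 0 < G z := fun z hz hzb => by
    rw [htail z hz]
    exact mul_pos (Real.rpow_pos_of_pos hz _)
      (H z hz ((hzb.trans_lt hbm).trans_le (min_le_left _ _))).1
  refine ⟨b, hb, hpos b hb le_rfl, fun n => ?_⟩
  suffices h : ∃ z > 0, z ≤ b ∧ 2 ^ n * G b ≤ G z from h.imp fun z hz => ⟨hz.1, hz.2.2⟩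
  induction n with
  | zero => exact ⟨b, hb, le_rfl, by simp⟩
  | succ n ih =>
    obtain ⟨z, hz, hzb, hG⟩ := ih
    have hzy : 0 < z / y := div_pos hz hy0
    refine ⟨z / y, hzy, (div_le_self hz.le hy1).trans hzb, ?_⟩
    have hzm := hzb.trans_lt hbm
    obtain ⟨hℓ, hr⟩ := H z hz (hzm.trans_le (min_le_left _ _))
    have h1 := hr y hy1 (by
      rw [Real.rpow_one]
      exact (neg_log_gt_of_lt_exp hz (hzm.trans_le (min_le_right _ _))).le)
    have h2 := (abs_le.1 h1).1
    have h3 : ℓ z / 2 ≤ ℓ (z / y) := by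
      have : 1 / 2 ≤ ℓ (z / y) / ℓ z := by linarith
      rw [le_div_iff₀ hℓ] at this
      linarith
    have h4 : G (z / y) = 4 * z ^ (-α) * ℓ (z / y) := by
      rw [htail _ hzy, Real.div_rpow hz.le hy0.le, hyα]
      ring
    have hzα := Real.rpow_pos_of_pos hz (-α)
    rw [pow_succ, h4]
    rw [htail z hz] at hG
    nlinarith

/-- The tail of the Lévy measure, with the scaling function, satisfies the analytic assumptions. -/
lemma isTailWithInverse_scaling {Λ : Measure ℝ} {α : ℝ} (hα : α ∈ Ioo (0 : ℝ) 2) {ℓ : ℝ → ℝ}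
    (hℓ : IsSuperSlowlyVarying ℓ (fun t => (-Real.log t)⁻¹))
    (htail : ∀ x : ℝ, 0 < x → (Λ (Ioi x)).toReal = x ^ (-α) * ℓ x) :
    (∀ c : ℝ, 0 < c → Λ (Ioi c) ≠ ∞) ∧
      IsTailWithInverse (fun c => (Λ (Ioi c)).toReal) ℓ (scaling Λ) α := by
  have hℓ0 : ∀ x, 0 < x → 0 ≤ ℓ x := by
    intro x hx
    have h1 : 0 ≤ x ^ (-α) * ℓ x := htail x hx ▸ ENNReal.toReal_nonneg
    exact nonneg_of_mul_nonneg_right h1 (Real.rpow_pos_of_pos hx _)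
  have hslow := hℓ.logUniformlySlowlyVarying hℓ0
  -- An infinite tail would persist at smaller levels and have `toReal` equal to `0` there,
  -- contradicting positivity of `ℓ` near `0`.
  have hfin : ∀ c : ℝ, 0 < c → Λ (Ioi c) ≠ ∞ := by
    intro c hc htop
    obtain ⟨β, hβ, H⟩ := hslow 1 1 one_pos
    have hm : 0 < min c (β / 2) := lt_min hc (by linarith)
    have h1 : Λ (Ioi (min c (β / 2))) = ∞ :=
      top_le_iff.1 (htop ▸ measure_mono (Ioi_subset_Ioi (min_le_left _ _)))
    have h2 := htail _ hm
    rw [h1, ENNReal.toReal_top] at h2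
    have h3 := (H _ hm ((min_le_right _ _).trans_lt (by linarith))).1
    exact (mul_pos (Real.rpow_pos_of_pos hm _) h3).ne h2
  have hanti := antitone_measureReal_Ioi hfin
  have hlim : Tendsto (fun c => (Λ (Ioi c)).toReal) atTop (𝓝 0) := by
    have h1 : Tendsto (fun c : ℝ => Λ (Ioi c)) atTop (𝓝 (Λ (⋂ c : ℝ, Ioi c))) :=
      tendsto_measure_iInter_atTop (fun _ => measurableSet_Ioi.nullMeasurableSet)
        (fun _ _ h => Ioi_subset_Ioi h) ⟨1, hfin 1 one_pos⟩
    have h2 : (⋂ c : ℝ, Ioi c) = ∅ := by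
      ext x
      simpa using ⟨x, le_rfl⟩
    rw [h2, measure_empty] at h1
    simpa [Function.comp_def] using (ENNReal.tendsto_toReal ENNReal.zero_ne_top).comp h1
  have hlt : ∀ s x : ℝ, 0 < s → 0 < x →
      (ENNReal.ofReal (1 / s) < Λ (Ioi x) ↔ 1 / s < (Λ (Ioi x)).toReal) := fun s x hs hx =>
    ENNReal.ofReal_lt_iff_lt_toReal (by positivity) (hfin x hx)
  have hbdd : ∀ s : ℝ, 0 < s → BddAbove {x : ℝ | 0 < x ∧ ENNReal.ofReal (1 / s) < Λ (Ioi x)} := by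
    intro s hs
    obtain ⟨C, hC, hC0⟩ := ((hlim.eventually (gt_mem_nhds (one_div_pos.2 hs))).and
      (eventually_gt_atTop 0)).exists
    refine ⟨C, fun x hx => ?_⟩
    by_contra hcon
    have h1 := (hlt s x hs hx.1).1 hx.2
    have h2 : (Λ (Ioi x)).toReal ≤ (Λ (Ioi C)).toReal :=
      hanti (mem_Ioi.2 hC0) (mem_Ioi.2 hx.1) (not_le.1 hcon).le
    linarith
  -- If the set were empty, its `sSup` would be `0` and `a(s)` would vanish; unboundedness of the
  -- tail at `0` excludes this.
  have hne : ∀ s : ℝ, 0 < s →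
      ({x : ℝ | 0 < x ∧ ENNReal.ofReal (1 / s) < Λ (Ioi x)}).Nonempty := by
    intro s hs
    by_contra hcon
    have hle : ∀ x : ℝ, 0 < x → (Λ (Ioi x)).toReal ≤ 1 / s := fun x hx => by
      by_contra h
      exact hcon ⟨x, hx, (hlt s x hs hx).2 (not_le.1 h)⟩
    obtain ⟨b, hb, hGb, hgrow⟩ := exists_doubling_of_logUniformlySlowlyVarying hα.1 (hslow 1) htail
    obtain ⟨n, hn⟩ := pow_unbounded_of_one_lt (1 / s / (Λ (Ioi b)).toReal) (one_lt_two (α := ℝ))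
    obtain ⟨z, hz, hzn⟩ := hgrow n
    rw [div_lt_iff₀ hGb] at hn
    linarith [hle z hz]
  refine ⟨hfin, hα.1, hα.2.le, fun _ _ => ENNReal.toReal_nonneg, hanti, hlim, htail, hslow,
    fun s hs => ?_, ?_, ?_, ?_⟩
  · obtain ⟨x, hx⟩ := hne s hs
    exact hx.1.trans_le (le_csSup (hbdd s hs) hx)
  · intro s hs t ht hst
    refine csSup_le_csSup (hbdd t ht) (hne s hs) fun x hx => ⟨hx.1, lt_of_le_of_lt ?_ hx.2⟩
    exact ENNReal.ofReal_le_ofReal (one_div_le_one_div_of_le hs hst)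
  · intro s x hs hx hxa
    obtain ⟨z, hz, hxz⟩ := exists_lt_of_lt_csSup (hne s hs) hxa
    exact ((hlt s z hs hz.1).1 hz.2).le.trans (hanti (mem_Ioi.2 hx) (mem_Ioi.2 hz.1) hxz.le)
  · intro s x hs hxa
    by_contra hcon
    have hx : 0 < x := by
      obtain ⟨z, hz⟩ := hne s hs
      exact (hz.1.trans_le (le_csSup (hbdd s hs) hz)).trans hxa
    exact hxa.not_ge (le_csSup (hbdd s hs) ⟨hx, (hlt s x hs hx).2 (not_le.1 hcon)⟩)

theorem theorem1 {Ω : Type*} [MeasurableSpace Ω] (P : Measure Ω) [IsProbabilityMeasure P]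
    (X : ℝ≥0 → Ω → ℝ) (hX : IsLevyProcess X P)
    (Λ : Measure ℝ) (hΛ : IsLevyMeasure X P Λ)
    (α : ℝ) (hα : α ∈ Ioo (0 : ℝ) 2) (ℓ : ℝ → ℝ)
    (hℓ : IsSuperSlowlyVarying ℓ (fun t => (-Real.log t)⁻¹))
    (htail : ∀ x : ℝ, 0 < x → (Λ (Ioi x)).toReal = x ^ (-α) * ℓ x)
    (x : ℝ) (hx : 0 < x) :
    Tendsto
      (fun t : ℝ≥0 =>
        (P {ω | scaledMaxJump Λ (fun s => X s ω) t * (-Real.log t) ^ (-1 / α) ≤ x}).toReal)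
      (𝓝[>] 0) (𝓝 (Real.exp (-x ^ (-α)))) := by
  obtain ⟨hfin, hG⟩ := isTailWithInverse_scaling hα hℓ htail
  have hcoe : Tendsto (fun t : ℝ≥0 => (t : ℝ)) (𝓝[>] 0) (𝓝[>] 0) :=
    tendsto_nhdsWithin_of_tendsto_nhds_of_eventually_within _
      ((NNReal.continuous_coe.tendsto 0).mono_left nhdsWithin_le_nhds)
      (by filter_upwards [self_mem_nhdsWithin] with t ht using NNReal.coe_pos.2 ht)
  have hlim := (Real.continuous_exp.tendsto _).comp ((hG.tendsto_integral hx).comp hcoe).neg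
  refine hlim.congr' ?_
  have hlt1 : ∀ᶠ t : ℝ≥0 in 𝓝[>] 0, t < 1 := nhdsWithin_le_nhds (gt_mem_nhds one_pos)
  filter_upwards [self_mem_nhdsWithin, hlt1] with t ht ht1
  have ht : 0 < t := ht
  have htR : (0 : ℝ) < t := ht
  have hL : 0 < -Real.log t := neg_pos.2 (Real.log_neg htR (by exact_mod_cast ht1))
  have hLp : 0 < (-Real.log t) ^ (1 / α) := Real.rpow_pos_of_pos hL _
  have hy : 0 < x * (-Real.log t) ^ (1 / α) := mul_pos hx hLp
  have hmax : ∀ u : ℝ, 0 < max u t := fun u => htR.trans_le (le_max_right _ _)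
  have key := hX.measure_jumps_le_barrier hΛ hfin
    (b := fun u => x * (-Real.log t) ^ (1 / α) * scaling Λ (max u t))
    (fun u v huv => mul_le_mul_of_nonneg_left
      (hG.inv_mono (hmax u) (hmax v) (max_le_max_right _ huv)) hy.le)
    (fun u => mul_pos hy (hG.inv_pos _ (hmax u)))
  simp only [Function.comp_apply]
  rw [← key, Measure.real]
  congr 1
  -- The two events are compared only on càdlàg paths, which have full measure, so no measurability
  -- of `scaledMaxJump` is needed.
  refine measure_congr ?_
  filter_upwards [hX.cadlag] with ω hω
  refine propext ?_
  change (∀ u ∈ Ioc (0 : ℝ≥0) 1, pathJump (fun t => X t ω) u ≤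
      x * (-Real.log t) ^ (1 / α) * scaling Λ (max (u : ℝ) t)) ↔
    scaledMaxJump Λ (fun s => X s ω) t * (-Real.log t) ^ (-1 / α) ≤ x
  rw [neg_div, Real.rpow_neg hL.le, ← div_eq_mul_inv, div_le_iff₀ hLp,
    scaledMaxJump_le_iff hω hG.inv_pos hG.inv_mono ht ht1.le hy]
  simp only [NNReal.coe_max]
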